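/- Let $\phi_1,\phi_2,\dots$ be an orthonormal system in the real space $\mathbb L_2(0,1)$ with norm $\|\cdot\|$. For $\varepsilon>0$ and $S\in\mathbb L_2(0,1)$ one observes $dY_\varepsilon(t)=S(t)\,dt+\varepsilon\,dw(t)$, $t\in[0,1]$, with $w$ a Wiener process, through $y_{\varepsilon j}=\int_0^1\phi_j\,dY_\varepsilon=\theta_j+\varepsilon\xi_j$, $j\ge1$, where $\theta_j=\int_0^1 S\phi_j\,dt$ and $\xi_j$ are independent standard normal variables. For given numbers $\varkappa_{\varepsilon j}$ ($\varepsilon>0$, $j\ge1$) put $$\rho_\varepsilon^2=\sum_{j\ge1}\varkappa_{\varepsilon j}^2<\infty,\qquad A_\varepsilon=\varepsilon^{-4}\sum_{j\ge1}\varkappa_{\varepsilon j}^4,\qquad T_\varepsilon=\varepsilon^{-2}\sum_{j\ge1}\varkappa_{\varepsilon j}^2y_{\varepsilon j}^2-\rho_\varepsilon^2,$$ $$k_\varepsilon=\sup\Bigl\{k:\sum_{j<k}\varkappa_{\varepsilon j}^2\le\tfrac12\rho_\varepsilon^2\Bigr\},\qquad \varkappa_\varepsilon^2=\varkappa_{\varepsilon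 k_\varepsilon}^2 .$$ All asymptotic relations are as $\varepsilon\to0+$; for nonnegative functions, $a_\varepsilon\asymp b_\varepsilon$ means $cb_\varepsilon\le a_\varepsilon\le Cb_\varepsilon$ for some $c,C>0$ and all sufficiently small $\varepsilon>0$; $[a]$ is the integer part. Assume: A1. For every $\varepsilon>0$ the sequence $\varkappa_{\varepsilon j}^2$, $j\ge1$, is non-increasing. A2. There are $C_1,C_2>0$ with $C_1<A_\varepsilon<C_2$ for all $\varepsilon>0$. A3. There are $C_1>0$ and $\lambda>1$ such that $\varkappa^2_{\varepsilon,[(1+\delta)k_\varepsilon]}<C_1(1+\delta)^{-\lambda}\varkappa_\varepsilon^2$ for all $\delta>0$ and $\varepsilon>0$. A4. $\varkappa_{\varepsilon1}^2\asymp\varkappa_\varepsilon^2$, and for every $c>1$ there is $C>0$ with $\varkappa^2_{\varepsilon,[ck_\varepsilon]}\ge C\varkappa_\varepsilon^2$ for all $\varepsilon>0$. Let $0<r<1/2$, $0<2\omega<1-2r$ and $k_\varepsilon\asymp\varepsilon^{-4+8r+4\omega}$. For a test $L_\varepsilon=\mathbf 1\{A_\varepsilon^{-1/2}T_\varepsilon>x_\varepsilon\}$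 with critical value $x_\varepsilon\in\mathbb R$ let $\alpha(L_\varepsilon)=\mathbf P_0(A_\varepsilon^{-1/2}T_\varepsilon>x_\varepsilon)$ and $\beta(L_\varepsilon,S)=\mathbf P_S(A_\varepsilon^{-1/2}T_\varepsilon\le x_\varepsilon)$ be its type I and type II error probabilities. A family $S_\varepsilon\in\mathbb L_2(0,1)$, $\varepsilon>0$, is called $r_\varepsilon$-LD consistent if for every such family of tests with $\alpha(L_\varepsilon)\in(0,1)$ for all $\varepsilon>0$ and $r_\varepsilon^{-2}\log\alpha(L_\varepsilon)\to0$ there is $C>0$ with $r_\varepsilon^2\le C\,|\log\beta(L_\varepsilon,S_\varepsilon)|$ for all sufficiently small $\varepsilon>0$. Put $s=\dfrac{r}{2-4r-2\omega}$ and, for $P_0>0$, $$\bar{\mathbb B}^s_{2\infty}(P_0)=\Bigl\{S=\sum_{j\ge1}\theta_j\phi_j\in\mathbb L_2(0,1):\ \theta_j\in\mathbb R,\ \sup_{\lambda>0}\lambda^{2s}\sum_{j>\lambda}\theta_j^2\le P_0\Bigr\}.$$ **Theorem.** Let $S_\varepsilon\in\mathbb L_2(0,1)$, $\varepsilon>0$,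 satisfy $\|S_\varepsilon\|\asymp\varepsilon^{2r}$. Then the family $S_\varepsilon$ is $\varepsilon^{-2\omega}$-LD consistent if and only if there are $P_0>0$ and functions $S_{1\varepsilon}\in\bar{\mathbb B}^s_{2\infty}(P_0)$, $\varepsilon>0$, with $\|S_{1\varepsilon}\|\asymp\varepsilon^{2r}$, such that for every $\varepsilon>0$ the function $S_{1\varepsilon}$ is orthogonal to $S_\varepsilon-S_{1\varepsilon}$, i.e. $$\|S_\varepsilon\|^2=\|S_{1\varepsilon}\|^2+\|S_\varepsilon-S_{1\varepsilon}\|^2 .$$ -/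

import Mathlib

open MeasureTheory ProbabilityTheory Filter Topology Asymptotics

/-- The real Hilbert space `L₂(0,1)`. -/
abbrev L2Unit : Type := Lp ℝ 2 (volume.restrict (Set.Ioo (0 : ℝ) 1))

namespace WhiteNoise

noncomputable section

/-- The Fourier coefficient `θ_j = ∫₀¹ S φ_j dt`. -/
def coeff (φ : ℕ+ → L2Unit) (S : L2Unit) (j : ℕ+) : ℝ := inner ℝ (φ j) S

/-- The set `B̄^s_{2∞}(P₀)` of the `S = ∑ θ_j φ_j` with `sup_{l > 0} l^{2s} ∑_{j > l} θ_j² ≤ P₀`. -/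
def besovBall (φ : ℕ+ → L2Unit) (s P₀ : ℝ) : Set L2Unit :=
  {S | ∃ θ : ℕ+ → ℝ, HasSum (fun j => θ j • φ j) S ∧
    ∀ l : ℝ, 0 < l → l ^ (2 * s) * ∑' j : ℕ+, (if l < (j : ℝ) then θ j ^ 2 else 0) ≤ P₀}

/-- Law of a sequence `ξ₁, ξ₂, …` of independent standard normal variables. -/
def noise : Measure (ℕ+ → ℝ) := Measure.infinitePi fun _ => gaussianReal 0 1

/-- The observations `y_{εj} = θ_j + ε ξ_j`, that is `y_{εj} = ∫ φ_j dY_ε` for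
`dY_ε(t) = S(t) dt + ε dw(t)`. -/
def obs (φ : ℕ+ → L2Unit) (ε : ℝ) (S : L2Unit) (ξ : ℕ+ → ℝ) (j : ℕ+) : ℝ :=
  coeff φ S j + ε * ξ j

/-! The weights `ϰ_{εj}` are given as `w ε j` with `j ≥ 1`; the value `w ε 0` is never used. -/

/-- `ρ_ε² = ∑_{j ≥ 1} ϰ_{εj}²`. -/
def rhoSq (w : ℝ → ℕ → ℝ) (ε : ℝ) : ℝ := ∑' j : ℕ+, w ε j ^ 2

/-- `A_ε = ε⁻⁴ ∑_{j ≥ 1} ϰ_{εj}⁴`. -/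
def bigA (w : ℝ → ℕ → ℝ) (ε : ℝ) : ℝ := (ε ^ 4)⁻¹ * ∑' j : ℕ+, w ε j ^ 4

/-- `k_ε = sup {k : ∑_{1 ≤ j < k} ϰ_{εj}² ≤ ρ_ε² / 2}`. -/
def kIdx (w : ℝ → ℕ → ℝ) (ε : ℝ) : ℕ :=
  sSup {k : ℕ | ∑ j ∈ Finset.Ico 1 k, w ε j ^ 2 ≤ rhoSq w ε / 2}

/-- `ϰ_ε² = ϰ_{ε k_ε}²`. -/
def kappaSq (w : ℝ → ℕ → ℝ) (ε : ℝ) : ℝ := w ε (kIdx w ε) ^ 2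

/-- Conditions A1 - A4 on the weights. -/
structure Conditions (w : ℝ → ℕ → ℝ) : Prop where
  /-- `ρ_ε²` is finite. -/
  summable : ∀ ε > 0, Summable fun j : ℕ+ => w ε j ^ 2
  A1 : ∀ ε > 0, AntitoneOn (fun j : ℕ => w ε j ^ 2) (Set.Ici 1)
  A2 : ∃ C₁ > 0, ∃ C₂ > 0, ∀ ε > 0, C₁ < bigA w ε ∧ bigA w ε < C₂
  A3 : ∃ C₁ > 0, ∃ lam > 1, ∀ δ > 0, ∀ ε > 0,
    w ε ⌊(1 + δ) * (kIdx w ε : ℝ)⌋₊ ^ 2 < C₁ * (1 + δ) ^ (-lam : ℝ) * kappaSq w ε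
  A4_first : (fun ε => w ε 1 ^ 2) =Θ[𝓝[>] 0] kappaSq w
  A4_tail : ∀ c : ℝ, 1 < c → ∃ C > 0, ∀ ε > 0,
    C * kappaSq w ε ≤ w ε ⌊c * (kIdx w ε : ℝ)⌋₊ ^ 2

/-- The statistic `T_ε(y) = ε⁻² ∑_{j ≥ 1} ϰ_{εj}² y_j² - ρ_ε²`. -/
def stat (w : ℝ → ℕ → ℝ) (ε : ℝ) (y : ℕ+ → ℝ) : ℝ :=
  (ε ^ 2)⁻¹ * (∑' j : ℕ+, w ε j ^ 2 * y j ^ 2) - rhoSq w ε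

/-- The rejection region of the test `L_ε = 1{A_ε^{-1/2} T_ε > x}`. -/
def rejection (w : ℝ → ℕ → ℝ) (ε x : ℝ) : Set (ℕ+ → ℝ) :=
  {y | x < (Real.sqrt (bigA w ε))⁻¹ * stat w ε y}

/-- The type I error probability of the test with critical value `x`. -/
def typeI (φ : ℕ+ → L2Unit) (w : ℝ → ℕ → ℝ) (ε x : ℝ) : ℝ :=
  noise.real {ξ | obs φ ε 0 ξ ∈ rejection w ε x}

/-- The type II error probability, at the alternative `S`, of the test with critical value `x`. -/
def typeII (φ : ℕ+ → L2Unit) (w : ℝ → ℕ → ℝ) (ε x : ℝ) (S : L2Unit) : ℝ :=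
  noise.real {ξ | obs φ ε S ξ ∉ rejection w ε x}

/-- `R_ε`-LD consistency of the family `S_ε` for the tests generated by `T_ε`: for all tests
`L_ε = 1{A_ε^{-1/2} T_ε > x_ε}` of levels `α_ε ∈ (0,1)` with `R_ε⁻² log α(L_ε) → 0` there is `C`
with `R_ε² ≤ C |log β(L_ε, S_ε)|` for all small `ε > 0`.
(`α < 1` only leaves out tests that always reject; for these `β = 0`.) -/
def LDConsistent (φ : ℕ+ → L2Unit) (w : ℝ → ℕ → ℝ) (R : ℝ → ℝ) (S : ℝ → L2Unit) : Prop :=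
  ∀ x : ℝ → ℝ,
    (∀ ε > 0, 0 < typeI φ w ε (x ε) ∧ typeI φ w ε (x ε) < 1) →
    Tendsto (fun ε => (R ε ^ 2)⁻¹ * Real.log (typeI φ w ε (x ε))) (𝓝[>] 0) (𝓝 0) →
    (fun ε => R ε ^ 2) =O[𝓝[>] 0] fun ε => Real.log (typeII φ w ε (x ε) (S ε))

end

end WhiteNoise

/-!
Centred and rescaled, `T_ε` is the quadratic form `∑ u_j (z_j + ξ_j)²`, where `u_j = ϰ_{εj}² / ε²`
and `z_j = θ_j / ε`; a signal shifts its mean by `D_ε = ε⁻⁴ ∑ ϰ_{εj}² θ_j²`. While `t u_1` is small,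
its cumulant generating function at `t` is linear plus quadratic in `t`, up to constants. Put
`R_ε = ε^{-2ω}`. By Chernoff's bound, `log α = o(R_ε²)` keeps the rescaled critical value below
`δ R_ε` for every `δ > 0`, and by its Paley–Zygmund converse every positive critical value `o(R_ε)`
is admissible; hence consistency means `R_ε = O(D_ε)`. Since `ϰ_{εj}²` is of order `ϰ_ε²` for
`j ≤ B k_ε` and of order at most `B^{-λ} ϰ_ε²` beyond, this says that for a large `B` the projection
of `S_ε` onto the first `B k_ε` basis functions has norm of order `ε^{2r}`. That projection belongs
to a ball of the Besov type because `k_ε^{-s} ≍ ε^{2r}`; conversely an orthogonal component in such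
a ball has a negligible tail beyond `B k_ε`, so the projection cannot be small.
-/

namespace WhiteNoise

section Gaussian

/-- The cumulant generating function, at `a < 1 / 2`, of `(z + N)²` with `N` standard normal. -/
noncomputable def sqCGF (a z : ℝ) : ℝ := a * z ^ 2 / (1 - 2 * a) - Real.log (1 - 2 * a) / 2

theorem lintegral_exp_mul_sq_gaussianReal {a : ℝ} (ha : a < 1 / 2) (z : ℝ) :
    ∫⁻ x, ENNReal.ofReal (Real.exp (a * (z + x) ^ 2)) ∂gaussianReal 0 1 =
      ENNReal.ofReal (Real.exp (sqCGF a z)) := by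
  have hb : 0 < 1 - 2 * a := by linarith
  have hvar : ((Real.toNNReal (1 - 2 * a)⁻¹ : NNReal) : ℝ) = (1 - 2 * a)⁻¹ :=
    Real.coe_toNNReal _ (by positivity)
  have hnorm : (√(2 * Real.pi * (1 - 2 * a)⁻¹))⁻¹ =
      (√(2 * Real.pi * ((1 : NNReal) : ℝ)))⁻¹ * Real.exp (Real.log (1 - 2 * a) / 2) := by
    rw [NNReal.coe_one, mul_one, Real.sqrt_mul (by positivity), mul_inv, Real.sqrt_inv, inv_inv,
      Real.exp_half, Real.exp_log hb]
  -- Completing the square turns the integrand into a multiple of another Gaussian density.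
  have hdensity : ∀ x : ℝ, gaussianPDF 0 1 x * ENNReal.ofReal (Real.exp (a * (z + x) ^ 2)) =
      ENNReal.ofReal (Real.exp (sqCGF a z)) *
        gaussianPDF (2 * a * z / (1 - 2 * a)) (Real.toNNReal (1 - 2 * a)⁻¹) x := by
    intro x
    rw [gaussianPDF, gaussianPDF, ← ENNReal.ofReal_mul (gaussianPDFReal_nonneg _ _ _),
      ← ENNReal.ofReal_mul (Real.exp_pos _).le, gaussianPDFReal, gaussianPDFReal, hvar, hnorm,
      mul_comm (Real.exp (sqCGF a z)), mul_assoc (_ : ℝ)⁻¹, ← Real.exp_add,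
      mul_assoc (_ : ℝ)⁻¹, ← Real.exp_add, mul_assoc (_ : ℝ)⁻¹, ← Real.exp_add]
    congr 3
    rw [sqCGF, NNReal.coe_one]
    field_simp
    ring
  rw [gaussianReal_of_var_ne_zero _ one_ne_zero,
    lintegral_withDensity_eq_lintegral_mul _ (measurable_gaussianPDF _ _) (by fun_prop)]
  simp only [Pi.mul_apply, hdensity]
  rw [lintegral_const_mul _ (measurable_gaussianPDF _ _),
    lintegral_gaussianPDF_eq_one _ (by simpa using hb), mul_one]

theorem sqCGF_le {a : ℝ} (ha₀ : 0 ≤ a) (ha : a ≤ 1 / 4) (z : ℝ) :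
    sqCGF a z ≤ a + 4 * a ^ 2 + 2 * (a * z ^ 2) := by
  have hb : 0 < 1 - 2 * a := by linarith
  have hquad : a * z ^ 2 / (1 - 2 * a) ≤ 2 * (a * z ^ 2) := by
    rw [div_le_iff₀ hb]
    nlinarith [mul_nonneg ha₀ (sq_nonneg z)]
  have hlog : -Real.log (1 - 2 * a) ≤ 2 * a + 8 * a ^ 2 := by
    rw [← Real.log_inv]
    refine (Real.log_le_sub_one_of_pos (by positivity)).trans ?_
    rw [inv_eq_one_div, sub_le_iff_le_add, div_le_iff₀ hb]
    nlinarith [pow_nonneg ha₀ 2]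
  rw [sqCGF]
  linarith

theorem add_sq_le_sqCGF_zero {a : ℝ} (ha₀ : 0 ≤ a) (ha : a < 1 / 2) :
    a + a ^ 2 ≤ sqCGF a 0 := by
  have hb : 0 < 1 - 2 * a := by linarith
  have hlog : 2 * a / (1 - a) ≤ -Real.log (1 - 2 * a) := by
    have h := Real.le_log_one_add_of_nonneg (x := 2 * a / (1 - 2 * a)) (by positivity)
    have hadd : 1 + 2 * a / (1 - 2 * a) = (1 - 2 * a)⁻¹ := by field_simp; ring
    have hdiv : 2 * (2 * a / (1 - 2 * a)) / (2 * a / (1 - 2 * a) + 2) = 2 * a / (1 - a) := by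
      have : 1 - a ≠ 0 := by linarith
      have : 2 * a + (1 - 2 * a) * 2 ≠ 0 := by linarith
      field_simp
      ring
    rwa [hadd, hdiv, Real.log_inv] at h
  have hgeom : 2 * a + 2 * a ^ 2 ≤ 2 * a / (1 - a) := by
    rw [le_div_iff₀ (by linarith)]
    nlinarith [pow_nonneg ha₀ 3]
  rw [sqCGF, zero_pow two_ne_zero, mul_zero, zero_div]
  linarith

theorem sqCGF_neg_le {a : ℝ} (ha₀ : 0 ≤ a) (ha : a ≤ 1 / 2) (z : ℝ) :
    sqCGF (-a) z ≤ -a + a ^ 2 - a * z ^ 2 / 2 := by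
  have hquad : a * z ^ 2 / 2 ≤ a * z ^ 2 / (1 + 2 * a) :=
    div_le_div_of_nonneg_left (by positivity) (by linarith) (by linarith)
  have hlog : 2 * a - 2 * a ^ 2 ≤ Real.log (1 + 2 * a) := by
    refine le_trans ?_ (Real.le_log_one_add_of_nonneg (x := 2 * a) (by positivity))
    rw [le_div_iff₀ (by linarith)]
    nlinarith [pow_nonneg ha₀ 3]
  rw [sqCGF, mul_neg, sub_neg_eq_add, neg_mul, neg_div]
  linarith

theorem abs_sqCGF_le {a : ℝ} (ha : a ≤ 1 / 4) (z : ℝ) :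
    |sqCGF a z| ≤ 2 * |a| * (1 + z ^ 2) := by
  have hb : 0 < 1 - 2 * a := by linarith
  have hinv : (1 - 2 * a)⁻¹ ≤ 2 := by rw [inv_le_comm₀ hb two_pos]; linarith
  have hquad : |a * z ^ 2 / (1 - 2 * a)| ≤ 2 * |a| * z ^ 2 := by
    rw [abs_div, abs_mul, abs_of_nonneg (sq_nonneg z), abs_of_pos hb, div_eq_mul_inv]
    nlinarith [mul_nonneg (abs_nonneg a) (sq_nonneg z)]
  have hlog : |Real.log (1 - 2 * a) / 2| ≤ 2 * |a| := by
    have hup := Real.log_le_sub_one_of_pos hb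
    have hlow := Real.one_sub_inv_le_log_of_pos hb
    have hsub : 1 - (1 - 2 * a)⁻¹ = -(2 * a * (1 - 2 * a)⁻¹) := by field_simp; ring
    rw [abs_le]
    constructor
    · nlinarith [le_abs_self a, abs_nonneg a, inv_pos.2 hb]
    · linarith [neg_abs_le a, abs_nonneg a]
  rw [sqCGF]
  linarith [abs_sub (a * z ^ 2 / (1 - 2 * a)) (Real.log (1 - 2 * a) / 2)]

theorem tendsto_sqCGF_neg_mul_div {a : ℝ} (ha : 0 ≤ a) (z : ℝ) :
    Tendsto (fun t : ℝ => sqCGF (-(t * a)) z / t) atTop (𝓝 0) := by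
  rcases ha.eq_or_lt with rfl | ha
  · simp [sqCGF]
  have hlin : Tendsto (fun t : ℝ => 1 + 2 * a * t) atTop atTop :=
    tendsto_atTop_add_const_left _ _ (tendsto_id.const_mul_atTop (by positivity))
  have hlog : Tendsto (fun t : ℝ => Real.log (1 + 2 * a * t) / t) atTop (𝓝 0) := by
    have hO : (fun t : ℝ => 1 + 2 * a * t) =O[atTop] fun t : ℝ => t :=
      (isLittleO_const_id_atTop (1 : ℝ)).isBigO.add (isBigO_const_mul_self _ _ _)
    exact ((Real.isLittleO_log_id_atTop.comp_tendsto hlin).trans_isBigO hO).tendsto_div_nhds_zero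
  have hquad : Tendsto (fun t : ℝ => a * z ^ 2 / (1 + 2 * a * t)) atTop (𝓝 0) :=
    tendsto_const_nhds.div_atTop hlin
  have hsum := (hquad.add (hlog.div_const 2)).neg
  rw [zero_div, add_zero, neg_zero] at hsum
  refine hsum.congr' ?_
  filter_upwards [eventually_gt_atTop 0] with t ht
  have hden : 1 - 2 * -(t * a) = 1 + 2 * a * t := by ring
  have hpos : 0 < 1 + 2 * a * t := by positivity
  rw [sqCGF, hden]
  field_simp
  ring

end Gaussian

section Moments

variable {Ω : Type*} {mΩ : MeasurableSpace Ω} {P : Measure Ω} {X : Ω → ℝ}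

theorem mgf_eq_exp_iff_lintegral (hX : AEMeasurable X P) {t c : ℝ} :
    mgf X P t = Real.exp c ↔
      ∫⁻ ω, ENNReal.ofReal (Real.exp (t * X ω)) ∂P = ENNReal.ofReal (Real.exp c) := by
  constructor <;> intro h
  · have hint : Integrable (fun ω => Real.exp (t * X ω)) P := by
      by_contra hint
      exact (Real.exp_pos c).ne (mgf_undef hint ▸ h)
    rw [← ofReal_integral_eq_lintegral_ofReal hint (ae_of_all _ fun _ => (Real.exp_pos _).le)]
    exact congrArg ENNReal.ofReal h
  · rw [mgf, integral_eq_lintegral_of_nonneg_ae (ae_of_all _ fun _ => (Real.exp_pos _).le)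
      (by fun_prop), h, ENNReal.toReal_ofReal (Real.exp_pos c).le]

theorem sq_setIntegral_le_integral_sq_mul_measureReal [IsFiniteMeasure P] (hX : MemLp X 2 P)
    {E : Set Ω} (hE : NullMeasurableSet E P) :
    (∫ ω in E, X ω ∂P) ^ 2 ≤ (∫ ω, X ω ^ 2 ∂P) * P.real E := by
  have hX₁ : Integrable X P := hX.integrable one_le_two
  have hnonneg : ∀ c : ℝ, 0 ≤ P.real E * (c * c) + -2 * (∫ ω in E, X ω ∂P) * c +
      ∫ ω, X ω ^ 2 ∂P := by
    intro c
    calc 0 ≤ (∫ ω in E, (X ω - c) ^ 2 ∂P) + ∫ ω in Eᶜ, X ω ^ 2 ∂P := by positivity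
      _ = (∫ ω in E, (X ω ^ 2 + -2 * c * X ω + c ^ 2) ∂P) + ∫ ω in Eᶜ, X ω ^ 2 ∂P := by
        congr 2
        funext ω
        ring
      _ = ((∫ ω in E, X ω ^ 2 ∂P) + -2 * c * (∫ ω in E, X ω ∂P) + P.real E * c ^ 2) +
          ∫ ω in Eᶜ, X ω ^ 2 ∂P := by
        have hlin : Integrable (fun ω => -2 * c * X ω) P := hX₁.const_mul _
        rw [integral_add (f := fun ω => X ω ^ 2 + -2 * c * X ω)
            (hX.integrable_sq.add hlin).restrict (integrable_const _),
          integral_add hX.integrable_sq.restrict hlin.restrict,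
          integral_const_mul, setIntegral_const, smul_eq_mul]
      _ = _ := by
        rw [← integral_add_compl₀ hE hX.integrable_sq]
        ring
  have hdiscrim := discrim_le_zero hnonneg
  rw [discrim] at hdiscrim
  linarith

variable [IsProbabilityMeasure P]

theorem paley_zygmund (hX : MemLp X 2 P) {θ : ℝ}
    (hθ₀ : 0 ≤ θ) (hθ₁ : θ ≤ 1) (hpos : 0 ≤ ∫ ω, X ω ∂P) :
    ((1 - θ) * ∫ ω, X ω ∂P) ^ 2 ≤
      (∫ ω, X ω ^ 2 ∂P) * P.real {ω | θ * ∫ ω, X ω ∂P < X ω} := by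
  set m := ∫ ω, X ω ∂P
  set E := {ω | θ * m < X ω}
  have hE : NullMeasurableSet E P := nullMeasurableSet_lt aemeasurable_const hX.1.aemeasurable
  have hX₁ : Integrable X P := hX.integrable one_le_two
  have hcompl : ∫ ω in Eᶜ, X ω ∂P ≤ θ * m :=
    calc ∫ ω in Eᶜ, X ω ∂P ≤ ∫ _ in Eᶜ, θ * m ∂P :=
          setIntegral_mono_on₀ hX₁.integrableOn (integrable_const _).integrableOn hE.compl
            fun ω hω => not_lt.1 hω
      _ ≤ θ * m := by
          rw [setIntegral_const, smul_eq_mul]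
          exact mul_le_of_le_one_left (mul_nonneg hθ₀ hpos) measureReal_le_one
  have hsplit : (∫ ω in E, X ω ∂P) + ∫ ω in Eᶜ, X ω ∂P = m := integral_add_compl₀ hE hX₁
  refine le_trans (pow_le_pow_left₀ (mul_nonneg (sub_nonneg.2 hθ₁) hpos) ?_ 2)
    (sq_setIntegral_le_integral_sq_mul_measureReal hX hE)
  linarith

theorem exp_cgf_div_four_le_measureReal_lt {t : ℝ}
    (h₁ : Integrable (fun ω => Real.exp (t * X ω)) P)
    (h₂ : Integrable (fun ω => Real.exp (2 * t * X ω)) P) :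
    Real.exp (2 * cgf X P t - cgf X P (2 * t)) / 4 ≤
      P.real {ω | cgf X P t - Real.log 2 < t * X ω} := by
  have hsq : ∀ ω, Real.exp (t * X ω) ^ 2 = Real.exp (2 * t * X ω) := fun ω => by
    rw [← Real.exp_nat_mul]
    congr 1
    push_cast
    ring
  have hL2 : MemLp (fun ω => Real.exp (t * X ω)) 2 P :=
    (memLp_two_iff_integrable_sq h₁.1).2 (by simpa only [hsq] using h₂)
  have hpz := paley_zygmund hL2 (θ := 1 / 2) (by norm_num)
    (by norm_num) (integral_nonneg fun ω => (Real.exp_pos _).le)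
  have hset : {ω | 1 / 2 * ∫ ω, Real.exp (t * X ω) ∂P < Real.exp (t * X ω)} =
      {ω | cgf X P t - Real.log 2 < t * X ω} := by
    ext ω
    change 1 / 2 * mgf X P t < _ ↔ _
    rw [Set.mem_ofPred, ← Real.exp_lt_exp (x := _ - _), Real.exp_sub, Real.exp_log two_pos,
      exp_cgf h₁, one_div_mul_eq_div]
  simp only [hsq] at hpz
  rw [hset] at hpz
  change ((1 - 1 / 2) * mgf X P t) ^ 2 ≤ mgf X P (2 * t) * _ at hpz
  rw [← exp_cgf h₁, ← exp_cgf h₂, mul_pow, ← Real.exp_nat_mul] at hpz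
  rw [Real.exp_sub, div_div, div_le_iff₀ (by positivity)]
  push_cast at hpz
  linarith

theorem measureReal_le_pos_of_tendsto_cgf_neg_div
    (hint : ∀ᶠ t in atTop, Integrable (fun ω => Real.exp (-t * X ω)) P)
    (hcgf : Tendsto (fun t => cgf X P (-t) / t) atTop (𝓝 0)) {τ : ℝ} (hτ : 0 < τ) :
    0 < P.real {ω | X ω ≤ τ} := by
  refine ENNReal.toReal_pos (fun hzero => ?_) (measure_ne_top _ _)
  have hlt : ∀ᵐ ω ∂P, τ < X ω := by
    rw [ae_iff]
    simpa only [not_lt] using hzero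
  suffices 0 ≤ -τ by linarith
  refine le_of_tendsto hcgf ?_
  filter_upwards [hint, eventually_gt_atTop 0] with t ht_int ht
  have hmgf : mgf X P (-t) ≤ Real.exp (-t * τ) := by
    calc mgf X P (-t) ≤ ∫ _, Real.exp (-t * τ) ∂P := by
          refine integral_mono_ae ht_int (integrable_const _) ?_
          filter_upwards [hlt] with ω hω
          exact Real.exp_le_exp.2 (mul_le_mul_of_nonpos_left hω.le (neg_nonpos.2 ht.le))
      _ = Real.exp (-t * τ) := by simp
  rw [← exp_cgf ht_int, Real.exp_le_exp] at hmgf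
  rw [div_le_iff₀ ht]
  linarith

end Moments

section QuadraticForm

variable {Ω ι : Type*} {mΩ : MeasurableSpace Ω} {P : Measure Ω} {ξ : ι → Ω → ℝ} {u z : ι → ℝ}

/-- The quadratic form `∑ uᵢ (zᵢ + ξᵢ)²` in the noise variables `ξᵢ`, with junk value `0` at the
points where the series diverges. -/
noncomputable def quad (u z : ι → ℝ) (ξ : ι → Ω → ℝ) (ω : Ω) : ℝ := ∑' i, u i * (z i + ξ i ω) ^ 2

theorem integral_add_sq_gaussianReal (z : ℝ) :
    ∫ x, (z + x) ^ 2 ∂gaussianReal 0 1 = z ^ 2 + 1 := by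
  have hid : MemLp id 2 (gaussianReal 0 1) := memLp_id_gaussianReal 2
  have hsq : ∫ x, x ^ 2 ∂gaussianReal 0 1 = 1 := by
    have h := variance_eq_sub hid
    rw [variance_id_gaussianReal] at h
    simpa using h.symm
  have hint₁ : Integrable (fun x : ℝ => 2 * z * x) (gaussianReal 0 1) :=
    (hid.integrable one_le_two).const_mul _
  have hint₂ : Integrable (fun x : ℝ => x ^ 2) (gaussianReal 0 1) := hid.integrable_sq
  simp only [add_sq]
  rw [integral_add (f := fun x => z ^ 2 + 2 * z * x) ((integrable_const _).add hint₁) hint₂,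
    integral_add (integrable_const _) hint₁, integral_const_mul, integral_id_gaussianReal, hsq]
  simp

theorem ae_summable_quad [Countable ι] (hξ : ∀ i, HasLaw (ξ i) (gaussianReal 0 1) P)
    (hu : Summable u) (hz : Summable fun i => u i * z i ^ 2) :
    ∀ᵐ ω ∂P, Summable fun i => u i * (z i + ξ i ω) ^ 2 := by
  have hnorm : ∀ i, eLpNorm (fun ω => u i * (z i + ξ i ω) ^ 2) 1 P =
      ENNReal.ofReal (|u i * z i ^ 2| + |u i|) := by
    intro i
    have hsq : Integrable (fun x : ℝ => (z i + x) ^ 2) (gaussianReal 0 1) :=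
      ((memLp_const (z i)).add (memLp_id_gaussianReal 2)).integrable_sq
    rw [eLpNorm_one_eq_lintegral_enorm,
      (hξ i).lintegral_comp (f := fun x => ‖u i * (z i + x) ^ 2‖ₑ) (by fun_prop),
      ← ofReal_integral_norm_eq_lintegral_enorm (hsq.const_mul (u i))]
    simp only [norm_mul, norm_pow, Real.norm_eq_abs, sq_abs]
    rw [integral_const_mul, integral_add_sq_gaussianReal, abs_mul, abs_of_nonneg (sq_nonneg (z i)),
      mul_add, mul_one]
  have hmeas : ∀ i, AEMeasurable (ξ i) P := fun i => (hξ i).aemeasurable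
  have hfin : ∑' i, eLpNorm (fun ω => u i * (z i + ξ i ω) ^ 2) 1 P ≠ ⊤ := by
    simp only [hnorm]
    exact (hz.abs.add hu.abs).tsum_ofReal_ne_top
  filter_upwards [summable_norm_of_tsum_eLpNorm_ne_top le_rfl (fun i => by fun_prop) hfin]
    with ω hω using hω.of_norm

theorem summable_sqCGF (hu : Summable u) (hz : Summable fun i => u i * z i ^ 2) (t : ℝ) :
    Summable fun i => sqCGF (t * u i) (z i) := by
  have hsmall : ∀ᶠ i in cofinite, t * u i ≤ 1 / 4 :=
    (hu.mul_left t).tendsto_cofinite_zero.eventually_le_const (by norm_num)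
  have hbound : Summable fun i => 2 * |t| * (|u i| + |u i * z i ^ 2|) :=
    (hu.abs.add hz.abs).mul_left _
  refine hbound.of_norm_bounded_eventually (hsmall.mono fun i hi => ?_)
  refine (abs_sqCGF_le hi (z i)).trans_eq ?_
  rw [abs_mul, abs_mul, abs_of_nonneg (sq_nonneg (z i))]
  ring

theorem mgf_sum_mul_add_sq (hξ : ∀ i, HasLaw (ξ i) (gaussianReal 0 1) P) (hind : iIndepFun ξ P)
    {t : ℝ} (ht : ∀ i, t * u i < 1 / 2) (s : Finset ι) :
    mgf (fun ω => ∑ i ∈ s, u i * (z i + ξ i ω) ^ 2) P t =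
      Real.exp (∑ i ∈ s, sqCGF (t * u i) (z i)) := by
  have hmeas : ∀ i, AEMeasurable (ξ i) P := fun i => (hξ i).aemeasurable
  have hterm : ∀ i, mgf (fun ω => u i * (z i + ξ i ω) ^ 2) P t =
      Real.exp (sqCGF (t * u i) (z i)) := by
    intro i
    rw [mgf_eq_exp_iff_lintegral (by fun_prop), ← lintegral_exp_mul_sq_gaussianReal (ht i),
      ← (hξ i).lintegral_comp (by fun_prop)]
    simp only [mul_assoc]
  have hind' : iIndepFun (fun i ω => u i * (z i + ξ i ω) ^ 2) P :=
    hind.comp (fun i x => u i * (z i + x) ^ 2) fun i => by fun_prop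
  have hsum := hind'.mgf_sum₀ (t := t) (fun i => by fun_prop) s
  simp only [hterm, ← Real.exp_sum] at hsum
  rw [← hsum]
  congr 1
  funext ω
  rw [Finset.sum_apply]

variable [Countable ι] (hξ : ∀ i, HasLaw (ξ i) (gaussianReal 0 1) P) (hind : iIndepFun ξ P)
  (hu₀ : ∀ i, 0 ≤ u i) (hu : Summable u) (hz : Summable fun i => u i * z i ^ 2)

include hξ in
theorem aemeasurable_quad : AEMeasurable (quad u z ξ) P := by
  have hmeas : ∀ i, AEMeasurable (ξ i) P := fun i => (hξ i).aemeasurable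
  exact AEMeasurable.tsum fun i => by fun_prop

include hξ hind hu₀ hu hz

theorem mgf_quad {t : ℝ} (ht : ∀ i, t * u i < 1 / 2) :
    mgf (quad u z ξ) P t = Real.exp (∑' i, sqCGF (t * u i) (z i)) := by
  have hmeas : ∀ i, AEMeasurable (ξ i) P := fun i => (hξ i).aemeasurable
  obtain ⟨s, hs_mono, hs⟩ := exists_seq_monotone_tendsto_atTop_atTop (Finset ι)
  set F : ℕ → Ω → ENNReal := fun n ω =>
    ENNReal.ofReal (Real.exp (t * ∑ i ∈ s n, u i * (z i + ξ i ω) ^ 2))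
  have hF_meas : ∀ n, AEMeasurable (F n) P := fun n => by fun_prop
  have hF_int : ∀ n, ∫⁻ ω, F n ω ∂P =
      ENNReal.ofReal (Real.exp (∑ i ∈ s n, sqCGF (t * u i) (z i))) := fun n =>
    (mgf_eq_exp_iff_lintegral (by fun_prop)).1 (mgf_sum_mul_add_sq hξ hind ht (s n))
  have hsum_mono : ∀ ω, Monotone fun n => ∑ i ∈ s n, u i * (z i + ξ i ω) ^ 2 := fun ω m n hmn =>
    Finset.sum_le_sum_of_subset_of_nonneg (hs_mono hmn) fun i _ _ =>
      mul_nonneg (hu₀ i) (sq_nonneg _)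
  have hF_lim : ∀ᵐ ω ∂P, Tendsto (fun n => F n ω) atTop
      (𝓝 (ENNReal.ofReal (Real.exp (t * quad u z ξ ω)))) := by
    filter_upwards [ae_summable_quad hξ hu hz] with ω hω
    exact ENNReal.tendsto_ofReal ((Real.continuous_exp.tendsto _).comp
      ((hω.hasSum.comp hs).const_mul t))
  rw [mgf_eq_exp_iff_lintegral (aemeasurable_quad hξ)]
  have hlim : Tendsto (fun n => ∫⁻ ω, F n ω ∂P) atTop
      (𝓝 (∫⁻ ω, ENNReal.ofReal (Real.exp (t * quad u z ξ ω)) ∂P)) := by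
    rcases le_total 0 t with ht₀ | ht₀
    · refine lintegral_tendsto_of_tendsto_of_monotone hF_meas (ae_of_all _ fun ω m n hmn => ?_)
        hF_lim
      exact ENNReal.ofReal_le_ofReal (Real.exp_le_exp.2
        (mul_le_mul_of_nonneg_left (hsum_mono ω hmn) ht₀))
    · refine lintegral_tendsto_of_tendsto_of_antitone hF_meas (ae_of_all _ fun ω m n hmn => ?_)
        (hF_int 0 ▸ ENNReal.ofReal_ne_top) hF_lim
      exact ENNReal.ofReal_le_ofReal (Real.exp_le_exp.2
        (mul_le_mul_of_nonpos_left (hsum_mono ω hmn) ht₀))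
  refine tendsto_nhds_unique hlim ?_
  simp only [hF_int]
  exact ENNReal.tendsto_ofReal ((Real.continuous_exp.tendsto _).comp
    ((summable_sqCGF hu hz t).hasSum.comp hs))

theorem integrable_exp_mul_quad {t : ℝ} (ht : ∀ i, t * u i < 1 / 2) :
    Integrable (fun ω => Real.exp (t * quad u z ξ ω)) P := by
  by_contra hint
  exact (Real.exp_pos _).ne (mgf_undef hint ▸ mgf_quad hξ hind hu₀ hu hz ht)

theorem cgf_quad {t : ℝ} (ht : ∀ i, t * u i < 1 / 2) :
    cgf (quad u z ξ) P t = ∑' i, sqCGF (t * u i) (z i) := by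
  rw [cgf, mgf_quad hξ hind hu₀ hu hz ht, Real.log_exp]

end QuadraticForm

theorem summable_sq_of_summable {ι : Type*} {u : ι → ℝ} (hu : Summable u) :
    Summable fun i => u i ^ 2 := by
  have hprod := summable_mul_of_summable_norm hu.norm hu.norm
  exact (hprod.comp_injective (i := fun i => (i, i)) fun i j h => congrArg Prod.fst h).congr
    fun i => (sq (u i)).symm

section QuadraticFormTails

variable {Ω ι : Type*} {mΩ : MeasurableSpace Ω} {P : Measure Ω} {ξ : ι → Ω → ℝ} {u z : ι → ℝ}
  [Countable ι] (hξ : ∀ i, HasLaw (ξ i) (gaussianReal 0 1) P) (hind : iIndepFun ξ P)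
  (hu₀ : ∀ i, 0 ≤ u i) (hu : Summable u) (hz : Summable fun i => u i * z i ^ 2)

include hξ hind hu₀ hu

theorem le_cgf_quad_zero {t : ℝ} (ht₀ : 0 ≤ t) (ht : ∀ i, t * u i < 1 / 2) :
    t * ∑' i, u i + t ^ 2 * ∑' i, u i ^ 2 ≤ cgf (quad u 0 ξ) P t := by
  have hz : Summable fun i => u i * (0 : ι → ℝ) i ^ 2 := by simp
  have hsq := summable_sq_of_summable hu
  rw [cgf_quad hξ hind hu₀ hu hz ht, ← tsum_mul_left, ← tsum_mul_left,
    ← (hu.mul_left _).tsum_add (hsq.mul_left _)]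
  refine ((hu.mul_left _).add (hsq.mul_left _)).tsum_le_tsum (fun i => ?_)
    (summable_sqCGF hu hz t)
  rw [← mul_pow]
  exact add_sq_le_sqCGF_zero (mul_nonneg ht₀ (hu₀ i)) (ht i)

include hz

theorem cgf_quad_le {t : ℝ} (ht₀ : 0 ≤ t) (ht : ∀ i, t * u i ≤ 1 / 4) :
    cgf (quad u z ξ) P t ≤
      t * ∑' i, u i + 4 * t ^ 2 * ∑' i, u i ^ 2 + 2 * t * ∑' i, u i * z i ^ 2 := by
  have hsq := summable_sq_of_summable hu
  rw [cgf_quad hξ hind hu₀ hu hz fun i => by linarith [ht i], ← tsum_mul_left, ← tsum_mul_left,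
    ← tsum_mul_left, ← (hu.mul_left _).tsum_add (hsq.mul_left _),
    ← ((hu.mul_left _).add (hsq.mul_left _)).tsum_add (hz.mul_left _)]
  refine (summable_sqCGF hu hz t).tsum_le_tsum (fun i => ?_)
    (((hu.mul_left _).add (hsq.mul_left _)).add (hz.mul_left _))
  exact (sqCGF_le (mul_nonneg ht₀ (hu₀ i)) (ht i) (z i)).trans_eq (by ring)

theorem cgf_quad_neg_le {t : ℝ} (ht₀ : 0 ≤ t) (ht : ∀ i, t * u i ≤ 1 / 2) :
    cgf (quad u z ξ) P (-t) ≤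
      -t * ∑' i, u i + t ^ 2 * ∑' i, u i ^ 2 - t / 2 * ∑' i, u i * z i ^ 2 := by
  have hsq := summable_sq_of_summable hu
  rw [cgf_quad hξ hind hu₀ hu hz fun i => by linarith [mul_nonneg ht₀ (hu₀ i)], ← tsum_mul_left,
    ← tsum_mul_left, ← tsum_mul_left, ← (hu.mul_left _).tsum_add (hsq.mul_left _),
    ← ((hu.mul_left _).add (hsq.mul_left _)).tsum_sub (hz.mul_left _)]
  refine (summable_sqCGF hu hz (-t)).tsum_le_tsum (fun i => ?_)
    (((hu.mul_left _).add (hsq.mul_left _)).sub (hz.mul_left _))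
  rw [neg_mul]
  exact (sqCGF_neg_le (mul_nonneg ht₀ (hu₀ i)) (ht i) (z i)).trans_eq (by ring)

theorem measureReal_lt_quad_le {t : ℝ} (ht₀ : 0 ≤ t) (ht : ∀ i, t * u i ≤ 1 / 4) (x : ℝ) :
    P.real {ω | ∑' i, u i + x < quad u z ξ ω} ≤
      Real.exp (-t * x + 4 * t ^ 2 * ∑' i, u i ^ 2 + 2 * t * ∑' i, u i * z i ^ 2) := by
  have := hind.isProbabilityMeasure
  calc P.real {ω | ∑' i, u i + x < quad u z ξ ω}
      ≤ P.real {ω | ∑' i, u i + x ≤ quad u z ξ ω} := by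
        refine measureReal_mono fun ω hω => ?_
        rw [Set.mem_ofPred] at hω ⊢
        exact hω.le
    _ ≤ Real.exp (-t * (∑' i, u i + x) + cgf (quad u z ξ) P t) :=
        measure_ge_le_exp_cgf _ ht₀
          (integrable_exp_mul_quad hξ hind hu₀ hu hz fun i => by linarith [ht i])
    _ ≤ _ := Real.exp_le_exp.2 (by linarith [cgf_quad_le hξ hind hu₀ hu hz ht₀ ht])

theorem measureReal_quad_le_le {t : ℝ} (ht₀ : 0 ≤ t) (ht : ∀ i, t * u i ≤ 1 / 2) (x : ℝ) :
    P.real {ω | quad u z ξ ω ≤ ∑' i, u i + x} ≤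
      Real.exp (t * x + t ^ 2 * ∑' i, u i ^ 2 - t / 2 * ∑' i, u i * z i ^ 2) := by
  have := hind.isProbabilityMeasure
  refine (measure_le_le_exp_cgf _ (neg_nonpos.2 ht₀) (integrable_exp_mul_quad hξ hind hu₀ hu hz
    fun i => by linarith [mul_nonneg ht₀ (hu₀ i)])).trans (Real.exp_le_exp.2 ?_)
  linarith [cgf_quad_neg_le hξ hind hu₀ hu hz ht₀ ht]

omit hz

theorem exp_div_four_le_measureReal_lt_quad {t x : ℝ} (ht₀ : 0 < t) (ht : ∀ i, t * u i ≤ 1 / 8)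
    (hx : x + Real.log 2 / t ≤ t * ∑' i, u i ^ 2) :
    Real.exp (-16 * t ^ 2 * ∑' i, u i ^ 2) / 4 ≤
      P.real {ω | ∑' i, u i + x < quad u 0 ξ ω} := by
  have := hind.isProbabilityMeasure
  have hz : Summable fun i => u i * (0 : ι → ℝ) i ^ 2 := by simp
  have hA : 0 ≤ ∑' i, u i ^ 2 := tsum_nonneg fun i => sq_nonneg _
  have hlow := le_cgf_quad_zero hξ hind hu₀ hu ht₀.le fun i => by linarith [ht i]
  have hup : cgf (quad u 0 ξ) P (2 * t) ≤ 2 * t * ∑' i, u i + 16 * t ^ 2 * ∑' i, u i ^ 2 := by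
    refine (cgf_quad_le hξ hind hu₀ hu hz (by positivity) fun i => by linarith [ht i]).trans_eq ?_
    simp only [Pi.zero_apply, zero_pow two_ne_zero, mul_zero, tsum_zero, add_zero]
    ring
  calc Real.exp (-16 * t ^ 2 * ∑' i, u i ^ 2) / 4
      ≤ Real.exp (2 * cgf (quad u 0 ξ) P t - cgf (quad u 0 ξ) P (2 * t)) / 4 := by
        gcongr
        nlinarith [mul_nonneg (sq_nonneg t) hA]
    _ ≤ P.real {ω | cgf (quad u 0 ξ) P t - Real.log 2 < t * quad u 0 ξ ω} :=
        exp_cgf_div_four_le_measureReal_lt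
          (integrable_exp_mul_quad hξ hind hu₀ hu hz fun i => by linarith [ht i])
          (integrable_exp_mul_quad hξ hind hu₀ hu hz fun i => by linarith [ht i])
    _ ≤ _ := by
        refine measureReal_mono fun ω hω => lt_of_mul_lt_mul_left ?_ ht₀.le
        have hscale := mul_le_mul_of_nonneg_left hx ht₀.le
        rw [mul_add, mul_div_cancel₀ _ ht₀.ne'] at hscale
        rw [Set.mem_ofPred] at hω
        linarith

end QuadraticFormTails

section QuadraticFormSupport

variable {Ω ι : Type*} {mΩ : MeasurableSpace Ω} {P : Measure Ω} {ξ : ι → Ω → ℝ} {u z : ι → ℝ}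
  [Countable ι] (hξ : ∀ i, HasLaw (ξ i) (gaussianReal 0 1) P)
  (hu₀ : ∀ i, 0 ≤ u i) (hu : Summable u) (hz : Summable fun i => u i * z i ^ 2)

include hξ hu₀ hu hz

theorem ae_term_le_quad (i : ι) : ∀ᵐ ω ∂P, u i * (z i + ξ i ω) ^ 2 ≤ quad u z ξ ω := by
  filter_upwards [ae_summable_quad hξ hu hz] with ω hω
  exact hω.le_tsum i fun j _ => mul_nonneg (hu₀ j) (sq_nonneg _)

theorem measureReal_lt_quad_pos [IsFiniteMeasure P] {i : ι} (hi : 0 < u i) (τ : ℝ) :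
    0 < P.real {ω | τ < quad u z ξ ω} := by
  refine ENNReal.toReal_pos (ne_of_gt ?_) (measure_ne_top _ _)
  have hopen : IsOpen {x : ℝ | τ < u i * (z i + x) ^ 2} :=
    isOpen_lt continuous_const (by fun_prop)
  have hmem : √((|τ| + 1) / u i) - z i ∈ {x : ℝ | τ < u i * (z i + x) ^ 2} := by
    rw [Set.mem_ofPred_eq, add_sub_cancel, Real.sq_sqrt (by positivity), mul_div_cancel₀ _ hi.ne']
    linarith [le_abs_self τ]
  have hpos : 0 < gaussianReal 0 1 {x : ℝ | τ < u i * (z i + x) ^ 2} :=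
    pos_iff_ne_zero.2 fun h => hopen.measure_ne_zero volume ⟨_, hmem⟩
      (gaussianReal_absolutelyContinuous' 0 one_ne_zero h)
  rw [← (hξ i).measure_eq hopen.measurableSet] at hpos
  refine hpos.trans_le (measure_mono_ae ?_)
  filter_upwards [ae_term_le_quad hξ hu₀ hu hz i] with ω hω hτ using lt_of_lt_of_le hτ hω

theorem ae_quad_pos {i : ι} (hi : 0 < u i) : ∀ᵐ ω ∂P, 0 < quad u z ξ ω := by
  have := nullSingletonClass_gaussianReal (μ := 0) (v := 1) one_ne_zero
  have hne : ∀ᵐ ω ∂P, ξ i ω ≠ -z i :=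
    ((hξ i).ae_iff (p := fun x => x ≠ -z i)
      (measurableSet_setOfPred.1 (measurableSet_singleton (-z i)).compl)).2 (by rw [ae_iff]; simp)
  filter_upwards [hne, ae_term_le_quad hξ hu₀ hu hz i] with ω hω hle
  have hne' : z i + ξ i ω ≠ 0 := fun h => hω (by linarith)
  exact lt_of_lt_of_le (by positivity) hle

theorem tendsto_cgf_quad_neg_div (hind : iIndepFun ξ P) :
    Tendsto (fun t => cgf (quad u z ξ) P (-t) / t) atTop (𝓝 0) := by
  have hterm : ∀ i, Tendsto (fun t => sqCGF (-t * u i) (z i) / t) atTop (𝓝 0) := fun i => by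
    simpa only [neg_mul] using tendsto_sqCGF_neg_mul_div (hu₀ i) (z i)
  have hlim : Tendsto (fun t => ∑' i, sqCGF (-t * u i) (z i) / t) atTop
      (𝓝 (∑' _ : ι, (0 : ℝ))) := by
    refine tendsto_tsum_of_dominated_convergence ((hu.add hz).mul_left 2) hterm ?_
    filter_upwards [eventually_gt_atTop 0] with t ht i
    have htu := mul_nonneg ht.le (hu₀ i)
    rw [norm_div, Real.norm_eq_abs, Real.norm_of_nonneg ht.le, div_le_iff₀ ht]
    refine (abs_sqCGF_le (by linarith) (z i)).trans_eq ?_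
    rw [neg_mul, abs_neg, abs_of_nonneg htu]
    ring
  rw [tsum_zero] at hlim
  refine hlim.congr' ?_
  filter_upwards [eventually_gt_atTop 0] with t ht
  rw [cgf_quad hξ hind hu₀ hu hz fun i => by linarith [mul_nonneg ht.le (hu₀ i)], tsum_div_const]

theorem measureReal_quad_le_pos (hind : iIndepFun ξ P) {τ : ℝ} (hτ : 0 < τ) :
    0 < P.real {ω | quad u z ξ ω ≤ τ} := by
  have := hind.isProbabilityMeasure
  refine measureReal_le_pos_of_tendsto_cgf_neg_div ?_
    (tendsto_cgf_quad_neg_div hξ hu₀ hu hz hind) hτ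
  filter_upwards [eventually_gt_atTop 0] with t ht
  exact integrable_exp_mul_quad hξ hind hu₀ hu hz fun i => by linarith [mul_nonneg ht.le (hu₀ i)]

end QuadraticFormSupport

theorem exists_frequently_mem_indicator_isLittleO {α E F : Type*} [SeminormedAddCommGroup E]
    [SeminormedAddCommGroup F] {l : Filter α} [l.IsCountablyGenerated] (hl : l ≤ cofinite)
    {f : α → E} {g : α → F} (h : ¬ g =O[l] f) :
    ∃ s : Set α, (∃ᶠ a in l, a ∈ s) ∧ s.indicator f =o[l] g := by
  obtain ⟨b, hb⟩ := l.exists_antitone_basis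
  have hsmall (n : ℕ) : ∃ a ∈ b n, n * ‖f a‖ < ‖g a‖ := by
    by_contra! hn
    exact h (IsBigO.of_bound n (mem_of_superset (hb.mem n) hn))
  choose e hmem hlt using hsmall
  refine ⟨Set.range e, (hb.tendsto hmem).frequently
    (Frequently.of_forall Set.mem_range_self), IsLittleO.of_bound fun c hc => ?_⟩
  obtain ⟨N, hN⟩ := exists_nat_gt c⁻¹
  have hfin : (e '' Set.Iio N).Finite := (Set.finite_Iio N).image e
  filter_upwards [hl hfin.compl_mem_cofinite] with a ha
  by_cases has : a ∈ Set.range e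
  · obtain ⟨n, rfl⟩ := has
    have hNn : (N : ℝ) ≤ n := by
      exact_mod_cast not_lt.1 fun hn => ha ⟨n, hn, rfl⟩
    rw [Set.indicator_of_mem (Set.mem_range_self n), ← inv_mul_le_iff₀ hc]
    exact (mul_le_mul_of_nonneg_right (hN.le.trans hNn) (norm_nonneg _)).trans (hlt n).le
  · rw [Set.indicator_of_notMem has, norm_zero]
    positivity

theorem isBigO_pow_mul_of_isBigO_div {f g : ℝ → ℝ} (n : ℕ)
    (h : f =O[𝓝[>] 0] fun ε => g ε / ε ^ n) : (fun ε => ε ^ n * f ε) =O[𝓝[>] 0] g :=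
  ((isBigO_refl (fun ε : ℝ => ε ^ n) (𝓝[>] 0)).mul h).congr' .rfl <| by
    filter_upwards [self_mem_nhdsWithin] with ε (hε : 0 < ε)
    exact mul_div_cancel₀ _ (by positivity)

section ErrorProbabilities

/-- The weights `ε⁻² ϰ_{εj}²` of the quadratic form in the variables `θ_j / ε + ξ_j` to which the
statistic `T_ε` reduces after centring and rescaling. -/
noncomputable def normWeight (w : ℝ → ℕ → ℝ) (ε : ℝ) (j : ℕ+) : ℝ := w ε j ^ 2 / ε ^ 2

/-- The critical value, on the scale of the quadratic form with weights `normWeight`, of the test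
`1{A_ε^{-1/2} T_ε > x}`. -/
noncomputable def critValue (w : ℝ → ℕ → ℝ) (ε x : ℝ) : ℝ := x * √(bigA w ε) / ε ^ 2

/-- The energy `∑ ϰ_{εj}² θ_j²` of a signal, which governs its detectability by `T_ε`: the signal
shifts the mean of the quadratic form with weights `normWeight` by `ε⁻⁴` times its energy. -/
noncomputable def energy (φ : ℕ+ → L2Unit) (w : ℝ → ℕ → ℝ) (ε : ℝ) (S : L2Unit) : ℝ :=
  ∑' j : ℕ+, w ε j ^ 2 * coeff φ S j ^ 2

variable {φ : ℕ+ → L2Unit} {w : ℝ → ℕ → ℝ} {ε t x : ℝ}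

theorem normWeight_nonneg (w : ℝ → ℕ → ℝ) (ε : ℝ) (j : ℕ+) : 0 ≤ normWeight w ε j := by
  unfold normWeight
  positivity

theorem energy_nonneg (φ : ℕ+ → L2Unit) (w : ℝ → ℕ → ℝ) (ε : ℝ) (S : L2Unit) :
    0 ≤ energy φ w ε S :=
  tsum_nonneg fun _ => by positivity

theorem coeff_zero (φ : ℕ+ → L2Unit) (j : ℕ+) : coeff φ 0 j = 0 := inner_zero_right _

theorem energy_zero (φ : ℕ+ → L2Unit) (w : ℝ → ℕ → ℝ) (ε : ℝ) : energy φ w ε 0 = 0 := by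
  simp [energy, coeff_zero]

theorem summable_coeff_sq (hφ : Orthonormal ℝ φ) (S : L2Unit) :
    Summable fun j => coeff φ S j ^ 2 := by
  simpa [coeff] using hφ.inner_products_summable (x := S)

theorem tsum_normWeight (w : ℝ → ℕ → ℝ) (ε : ℝ) :
    ∑' j, normWeight w ε j = rhoSq w ε / ε ^ 2 := by
  simp only [normWeight, tsum_div_const, rhoSq]

theorem tsum_normWeight_sq (w : ℝ → ℕ → ℝ) (ε : ℝ) :
    ∑' j, normWeight w ε j ^ 2 = bigA w ε := by
  rw [bigA, ← tsum_mul_left]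
  refine tsum_congr fun j => ?_
  rw [normWeight, div_pow, div_eq_inv_mul, ← pow_mul, ← pow_mul]

theorem normWeight_mul_coeff_div_sq (φ : ℕ+ → L2Unit) (w : ℝ → ℕ → ℝ) (ε : ℝ) (S : L2Unit)
    (j : ℕ+) :
    normWeight w ε j * (coeff φ S j / ε) ^ 2 = w ε j ^ 2 * coeff φ S j ^ 2 / ε ^ 4 := by
  rw [normWeight, div_pow, div_mul_div_comm, ← pow_add]

theorem tsum_normWeight_mul_sq (φ : ℕ+ → L2Unit) (w : ℝ → ℕ → ℝ) (ε : ℝ) (S : L2Unit) :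
    ∑' j, normWeight w ε j * (coeff φ S j / ε) ^ 2 = energy φ w ε S / ε ^ 4 := by
  simp only [normWeight_mul_coeff_div_sq, tsum_div_const, energy]

instance : IsProbabilityMeasure noise := by
  unfold noise
  infer_instance

theorem hasLaw_eval_noise (j : ℕ+) :
    HasLaw (fun ξ : ℕ+ → ℝ => ξ j) (gaussianReal 0 1) noise :=
  (measurePreserving_eval_infinitePi (fun _ : ℕ+ => gaussianReal 0 1) j).hasLaw

theorem iIndepFun_eval_noise : iIndepFun (fun (j : ℕ+) (ξ : ℕ+ → ℝ) => ξ j) noise :=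
  iIndepFun_infinitePi (P := fun _ : ℕ+ => gaussianReal 0 1) (X := fun _ x => x)
    fun _ => measurable_id

theorem stat_obs (φ : ℕ+ → L2Unit) (w : ℝ → ℕ → ℝ) (hε : 0 < ε) (S : L2Unit) (ξ : ℕ+ → ℝ) :
    stat w ε (obs φ ε S ξ) = ε ^ 2 *
      (quad (normWeight w ε) (fun j => coeff φ S j / ε) (fun j ξ => ξ j) ξ -
        ∑' j, normWeight w ε j) := by
  have hterm (j : ℕ+) : w ε j ^ 2 * obs φ ε S ξ j ^ 2 =
      ε ^ 4 * (normWeight w ε j * (coeff φ S j / ε + ξ j) ^ 2) := by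
    rw [normWeight, obs]
    field_simp
  rw [stat, tsum_congr hterm, tsum_mul_left, tsum_normWeight, quad]
  field_simp

theorem obs_mem_rejection_iff (φ : ℕ+ → L2Unit) (hε : 0 < ε) (hA : 0 < bigA w ε) (S : L2Unit)
    (x : ℝ) (ξ : ℕ+ → ℝ) :
    obs φ ε S ξ ∈ rejection w ε x ↔ ∑' j, normWeight w ε j + critValue w ε x <
      quad (normWeight w ε) (fun j => coeff φ S j / ε) (fun j ξ => ξ j) ξ := by
  have hs : 0 < √(bigA w ε) := Real.sqrt_pos.2 hA
  rw [rejection, Set.mem_ofPred, stat_obs φ w hε, ← div_eq_inv_mul, lt_div_iff₀ hs,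
    ← lt_sub_iff_add_lt', critValue, div_lt_iff₀ (by positivity), mul_comm (ε ^ 2)]

theorem surjective_critValue (hε : 0 < ε) (hA : 0 < bigA w ε) :
    Function.Surjective (critValue w ε) := fun c => by
  have hs : 0 < √(bigA w ε) := Real.sqrt_pos.2 hA
  exact ⟨c * ε ^ 2 / √(bigA w ε), by rw [critValue]; field_simp⟩

namespace Conditions

variable (hw : Conditions w)

include hw

theorem bigA_pos (hε : 0 < ε) : 0 < bigA w ε := by
  obtain ⟨C₁, h₁, C₂, -, h⟩ := hw.A2
  exact h₁.trans (h ε hε).1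

theorem sq_le_first (hε : 0 < ε) (j : ℕ+) : w ε j ^ 2 ≤ w ε 1 ^ 2 :=
  hw.A1 ε hε (Set.mem_Ici.2 le_rfl) (Set.mem_Ici.2 j.2) j.2

theorem normWeight_le_one (hε : 0 < ε) (j : ℕ+) : normWeight w ε j ≤ normWeight w ε 1 :=
  div_le_div_of_nonneg_right (hw.sq_le_first hε j) (sq_nonneg ε)

theorem normWeight_one_pos (hε : 0 < ε) : 0 < normWeight w ε 1 := by
  refine (normWeight_nonneg w ε 1).lt_of_ne' fun h => (hw.bigA_pos hε).ne' ?_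
  have hzero (j : ℕ+) : normWeight w ε j = 0 :=
    le_antisymm (h ▸ hw.normWeight_le_one hε j) (normWeight_nonneg w ε j)
  simp [← tsum_normWeight_sq, hzero]

theorem summable_normWeight (hε : 0 < ε) : Summable (normWeight w ε) :=
  (hw.summable ε hε).div_const _

theorem summable_sq_mul_sq (hε : 0 < ε) {θ : ℕ+ → ℝ} (hθ : Summable fun j => θ j ^ 2) :
    Summable fun j : ℕ+ => w ε j ^ 2 * θ j ^ 2 :=
  .of_nonneg_of_le (fun _ => by positivity)
    (fun j => mul_le_mul_of_nonneg_right (hw.sq_le_first hε j) (sq_nonneg _)) (hθ.mul_left _)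

theorem summable_normWeight_mul_sq (hφ : Orthonormal ℝ φ) (hε : 0 < ε) (S : L2Unit) :
    Summable fun j => normWeight w ε j * (coeff φ S j / ε) ^ 2 := by
  simp only [normWeight_mul_coeff_div_sq]
  exact (hw.summable_sq_mul_sq hε (summable_coeff_sq hφ S)).div_const _

theorem typeI_eq (φ : ℕ+ → L2Unit) (hε : 0 < ε) (x : ℝ) :
    typeI φ w ε x = noise.real {ξ | ∑' j, normWeight w ε j + critValue w ε x <
      quad (normWeight w ε) 0 (fun j ξ => ξ j) ξ} := by
  have hzero : (fun j => coeff φ 0 j / ε) = 0 := funext fun j => by simp [coeff_zero]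
  simp only [typeI, obs_mem_rejection_iff φ hε (hw.bigA_pos hε), hzero]

theorem typeII_eq (φ : ℕ+ → L2Unit) (hε : 0 < ε) (x : ℝ) (S : L2Unit) :
    typeII φ w ε x S =
      noise.real {ξ | quad (normWeight w ε) (fun j => coeff φ S j / ε) (fun j ξ => ξ j) ξ ≤
        ∑' j, normWeight w ε j + critValue w ε x} := by
  simp only [typeII, obs_mem_rejection_iff φ hε (hw.bigA_pos hε), not_lt]

theorem one_sub_typeII_eq (φ : ℕ+ → L2Unit) (hε : 0 < ε) (x : ℝ) (S : L2Unit) :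
    1 - typeII φ w ε x S = noise.real {ξ | ∑' j, normWeight w ε j + critValue w ε x <
      quad (normWeight w ε) (fun j => coeff φ S j / ε) (fun j ξ => ξ j) ξ} := by
  rw [hw.typeII_eq φ hε, ← probReal_compl_eq_one_sub₀
    (nullMeasurableSet_le (aemeasurable_quad hasLaw_eval_noise) aemeasurable_const)]
  simp only [Set.compl_ofPred, not_le]

theorem typeI_eq_one_sub_typeII_zero (φ : ℕ+ → L2Unit) (hε : 0 < ε) (x : ℝ) :
    typeI φ w ε x = 1 - typeII φ w ε x 0 := by
  simp only [hw.one_sub_typeII_eq φ hε, typeI, obs_mem_rejection_iff φ hε (hw.bigA_pos hε)]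

theorem one_sub_typeII_le (hφ : Orthonormal ℝ φ) (hε : 0 < ε) (ht₀ : 0 ≤ t)
    (ht : t * normWeight w ε 1 ≤ 1 / 4) (x : ℝ) (S : L2Unit) :
    1 - typeII φ w ε x S ≤ Real.exp
      (-t * critValue w ε x + 4 * t ^ 2 * bigA w ε + 2 * t * (energy φ w ε S / ε ^ 4)) := by
  rw [hw.one_sub_typeII_eq φ hε, ← tsum_normWeight_mul_sq, ← tsum_normWeight_sq]
  exact measureReal_lt_quad_le hasLaw_eval_noise iIndepFun_eval_noise (normWeight_nonneg w ε)
    (hw.summable_normWeight hε) (hw.summable_normWeight_mul_sq hφ hε S) ht₀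
    (fun j => (mul_le_mul_of_nonneg_left (hw.normWeight_le_one hε j) ht₀).trans ht) _

theorem typeI_le (hφ : Orthonormal ℝ φ) (hε : 0 < ε) (ht₀ : 0 ≤ t)
    (ht : t * normWeight w ε 1 ≤ 1 / 4) (x : ℝ) :
    typeI φ w ε x ≤ Real.exp (-t * critValue w ε x + 4 * t ^ 2 * bigA w ε) := by
  simpa [hw.typeI_eq_one_sub_typeII_zero φ hε, energy_zero]
    using hw.one_sub_typeII_le hφ hε ht₀ ht x 0

theorem typeII_le (hφ : Orthonormal ℝ φ) (hε : 0 < ε) (ht₀ : 0 ≤ t)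
    (ht : t * normWeight w ε 1 ≤ 1 / 2) (x : ℝ) (S : L2Unit) :
    typeII φ w ε x S ≤ Real.exp
      (t * critValue w ε x + t ^ 2 * bigA w ε - t / 2 * (energy φ w ε S / ε ^ 4)) := by
  rw [hw.typeII_eq φ hε, ← tsum_normWeight_mul_sq, ← tsum_normWeight_sq]
  exact measureReal_quad_le_le hasLaw_eval_noise iIndepFun_eval_noise (normWeight_nonneg w ε)
    (hw.summable_normWeight hε) (hw.summable_normWeight_mul_sq hφ hε S) ht₀
    (fun j => (mul_le_mul_of_nonneg_left (hw.normWeight_le_one hε j) ht₀).trans ht) _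

theorem exp_div_four_le_typeI (φ : ℕ+ → L2Unit) (hε : 0 < ε) (ht₀ : 0 < t)
    (ht : t * normWeight w ε 1 ≤ 1 / 8)
    (hx : critValue w ε x + Real.log 2 / t ≤ t * bigA w ε) :
    Real.exp (-16 * t ^ 2 * bigA w ε) / 4 ≤ typeI φ w ε x := by
  rw [← tsum_normWeight_sq] at hx ⊢
  rw [hw.typeI_eq φ hε]
  exact exp_div_four_le_measureReal_lt_quad hasLaw_eval_noise iIndepFun_eval_noise
    (normWeight_nonneg w ε) (hw.summable_normWeight hε) ht₀
    (fun j => (mul_le_mul_of_nonneg_left (hw.normWeight_le_one hε j) ht₀.le).trans ht) hx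

theorem le_log_typeI (φ : ℕ+ → L2Unit) (hε : 0 < ε) (ht₁ : 1 ≤ t)
    (ht : t * normWeight w ε 1 ≤ 1 / 8) (hx : critValue w ε x + 1 ≤ t * bigA w ε) :
    -16 * t ^ 2 * bigA w ε - Real.log 4 ≤ Real.log (typeI φ w ε x) := by
  have ht₀ : 0 < t := zero_lt_one.trans_le ht₁
  have hlog : Real.log 2 / t ≤ 1 := by
    rw [div_le_one ht₀]
    linarith [Real.log_two_lt_d9]
  have hle := Real.log_le_log (div_pos (Real.exp_pos _) four_pos)
    (hw.exp_div_four_le_typeI φ hε ht₀ ht ((add_le_add_right hlog _).trans hx))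
  rwa [Real.log_div (Real.exp_ne_zero _) (by norm_num), Real.log_exp] at hle

theorem typeI_pos (φ : ℕ+ → L2Unit) (hε : 0 < ε) (x : ℝ) : 0 < typeI φ w ε x := by
  rw [hw.typeI_eq φ hε]
  exact measureReal_lt_quad_pos hasLaw_eval_noise (normWeight_nonneg w ε)
    (hw.summable_normWeight hε) (by simp) (hw.normWeight_one_pos hε) _

theorem typeII_pos (hφ : Orthonormal ℝ φ) (hε : 0 < ε)
    (hx : 0 < ∑' j, normWeight w ε j + critValue w ε x) (S : L2Unit) :
    0 < typeII φ w ε x S := by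
  rw [hw.typeII_eq φ hε]
  exact measureReal_quad_le_pos hasLaw_eval_noise (normWeight_nonneg w ε)
    (hw.summable_normWeight hε) (hw.summable_normWeight_mul_sq hφ hε S) iIndepFun_eval_noise hx

theorem typeI_lt_one (hφ : Orthonormal ℝ φ) (hε : 0 < ε)
    (hx : 0 < ∑' j, normWeight w ε j + critValue w ε x) : typeI φ w ε x < 1 := by
  linarith [hw.typeI_eq_one_sub_typeII_zero φ hε x, hw.typeII_pos hφ hε hx 0]

theorem tsum_normWeight_add_critValue_pos (hε : 0 < ε) (hx : typeI φ w ε x < 1) :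
    0 < ∑' j, normWeight w ε j + critValue w ε x := by
  contrapose! hx
  rw [hw.typeI_eq φ hε, measureReal_congr (eventuallyEq_univ.2 ?_), probReal_univ]
  filter_upwards [ae_quad_pos hasLaw_eval_noise (normWeight_nonneg w ε)
    (hw.summable_normWeight hε) (z := 0) (by simp) (hw.normWeight_one_pos hε)] with ξ hξ
  exact hx.trans_lt hξ

end Conditions

end ErrorProbabilities

section ModerateDeviations

namespace Conditions

variable {φ : ℕ+ → L2Unit} {w : ℝ → ℕ → ℝ} {R x : ℝ → ℝ} {S : ℝ → L2Unit} (hw : Conditions w)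

include hw

theorem eventually_critValue_le (hφ : Orthonormal ℝ φ) (hR : Tendsto R (𝓝[>] 0) atTop)
    (hwR : Tendsto (fun ε => normWeight w ε 1 * R ε) (𝓝[>] 0) (𝓝 0))
    (hα : Tendsto (fun ε => (R ε ^ 2)⁻¹ * Real.log (typeI φ w ε (x ε))) (𝓝[>] 0) (𝓝 0))
    {δ : ℝ} (hδ : 0 < δ) : ∀ᶠ ε in 𝓝[>] 0, critValue w ε (x ε) ≤ δ * R ε := by
  obtain ⟨C₁, -, C₂, hC₂, hA⟩ := hw.A2
  set c := δ / (8 * C₂) with hc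
  have hc₀ : 0 < c := by positivity
  have hlevel : -(δ ^ 2 / (16 * C₂)) < 0 := neg_lt_zero.2 (by positivity)
  have hc₄ : 0 < 1 / 4 / c := by positivity
  filter_upwards [hα.eventually_const_lt hlevel, hwR.eventually_lt_const hc₄,
    hR.eventually_gt_atTop 0, self_mem_nhdsWithin] with ε hlog hsmall hRε hε
  by_contra! hx
  rw [← div_eq_inv_mul, lt_div_iff₀ (by positivity)] at hlog
  rw [lt_div_iff₀ hc₀] at hsmall
  have hle := Real.log_le_log (hw.typeI_pos φ hε (x ε))
    (hw.typeI_le hφ hε (t := c * R ε) (by positivity) (by linarith) (x ε))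
  rw [Real.log_exp] at hle
  have hbound : -(c * R ε) * critValue w ε (x ε) + 4 * (c * R ε) ^ 2 * bigA w ε ≤
      -(δ ^ 2 / (16 * C₂)) * R ε ^ 2 :=
    calc -(c * R ε) * critValue w ε (x ε) + 4 * (c * R ε) ^ 2 * bigA w ε
        ≤ 4 * (c * R ε) ^ 2 * C₂ - (c * R ε) * (δ * R ε) := by
          rw [neg_mul, neg_add_eq_sub]
          gcongr
          exact (hA ε hε).2.le
      _ = -(δ ^ 2 / (16 * C₂)) * R ε ^ 2 := by
          rw [hc]
          field_simp
          ring
  linarith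

theorem isBigO_log_typeII (hφ : Orthonormal ℝ φ) (hR : Tendsto R (𝓝[>] 0) atTop)
    (hwR : Tendsto (fun ε => normWeight w ε 1 * R ε) (𝓝[>] 0) (𝓝 0))
    (hS : (fun ε => ε ^ 4 * R ε) =O[𝓝[>] 0] fun ε => energy φ w ε (S ε))
    (hα₁ : ∀ ε > 0, typeI φ w ε (x ε) < 1)
    (hα : Tendsto (fun ε => (R ε ^ 2)⁻¹ * Real.log (typeI φ w ε (x ε))) (𝓝[>] 0) (𝓝 0)) :
    (fun ε => R ε ^ 2) =O[𝓝[>] 0] fun ε => Real.log (typeII φ w ε (x ε) (S ε)) := by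
  obtain ⟨C₁, -, C₂, hC₂, hA⟩ := hw.A2
  obtain ⟨K, hK, hKS⟩ := hS.exists_pos
  set c := K⁻¹ with hc
  have hc₀ : 0 < c := by positivity
  set a := c / (8 * C₂) with ha
  have ha₀ : 0 < a := by positivity
  have ha₂ : 0 < 1 / 2 / a := by positivity
  refine IsBigO.of_bound (a * c / 8)⁻¹ ?_
  filter_upwards [hw.eventually_critValue_le hφ hR hwR hα (δ := c / 4) (by positivity), hKS.bound,
    hwR.eventually_lt_const ha₂, hR.eventually_gt_atTop 0, self_mem_nhdsWithin]
    with ε hx hsignal hsmall hRε (hε : 0 < ε)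
  rw [lt_div_iff₀ ha₀] at hsmall
  rw [Real.norm_of_nonneg (by positivity), Real.norm_of_nonneg (energy_nonneg φ w ε (S ε))]
    at hsignal
  have henergy : c * R ε ≤ energy φ w ε (S ε) / ε ^ 4 := by
    rwa [le_div_iff₀ (by positivity), hc, mul_assoc, inv_mul_le_iff₀ hK, mul_comm (R ε)]
  have hle := Real.log_le_log
    (hw.typeII_pos hφ hε (hw.tsum_normWeight_add_critValue_pos hε (hα₁ ε hε)) (S ε))
    (hw.typeII_le hφ hε (t := a * R ε) (by positivity) (by linarith) (x ε) (S ε))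
  rw [Real.log_exp] at hle
  have hbound : a * R ε * critValue w ε (x ε) + (a * R ε) ^ 2 * bigA w ε -
      a * R ε / 2 * (energy φ w ε (S ε) / ε ^ 4) ≤ -(a * c / 8) * R ε ^ 2 :=
    calc _ ≤ a * R ε * (c / 4 * R ε) + (a * R ε) ^ 2 * C₂ - a * R ε / 2 * (c * R ε) := by
          gcongr
          exact (hA ε hε).2.le
      _ = -(a * c / 8) * R ε ^ 2 := by
          rw [ha]
          field_simp
          ring
  rw [Real.norm_of_nonneg (sq_nonneg _), Real.norm_eq_abs, ← div_eq_inv_mul,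
    le_div_iff₀ (by positivity)]
  linarith [neg_le_abs (Real.log (typeII φ w ε (x ε) (S ε)))]

theorem tendsto_log_typeI (φ : ℕ+ → L2Unit) (hR : Tendsto R (𝓝[>] 0) atTop)
    (hwR : Tendsto (fun ε => normWeight w ε 1 * R ε) (𝓝[>] 0) (𝓝 0))
    (hx₀ : ∀ ε > 0, 0 ≤ critValue w ε (x ε))
    (hx : (fun ε => critValue w ε (x ε)) =o[𝓝[>] 0] R) :
    Tendsto (fun ε => (R ε ^ 2)⁻¹ * Real.log (typeI φ w ε (x ε))) (𝓝[>] 0) (𝓝 0) := by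
  obtain ⟨C₁, hC₁, C₂, -, hA⟩ := hw.A2
  have hRinv : Tendsto (fun ε => (R ε)⁻¹) (𝓝[>] 0) (𝓝 0) := hR.inv_tendsto_atTop
  set t : ℝ → ℝ := fun ε => (critValue w ε (x ε) + 1) / C₁ + 1 with ht
  have htR : Tendsto (fun ε => t ε / R ε) (𝓝[>] 0) (𝓝 0) := by
    have h := ((hx.tendsto_div_nhds_zero.add hRinv).div_const C₁).add hRinv
    simp only [add_zero, zero_div] at h
    exact h.congr fun ε => by rw [ht]; ring
  have hlow : Tendsto (fun ε => -(16 * C₂) * (t ε / R ε) ^ 2 - Real.log 4 * (R ε)⁻¹ ^ 2)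
      (𝓝[>] 0) (𝓝 0) := by
    simpa using ((htR.pow 2).const_mul (-(16 * C₂))).sub ((hRinv.pow 2).const_mul (Real.log 4))
  have htw : Tendsto (fun ε => t ε / R ε * (normWeight w ε 1 * R ε)) (𝓝[>] 0) (𝓝 0) := by
    simpa using htR.mul hwR
  refine tendsto_of_tendsto_of_tendsto_of_le_of_le' hlow tendsto_const_nhds ?_
    (.of_forall fun ε => mul_nonpos_of_nonneg_of_nonpos (by positivity)
      (Real.log_nonpos measureReal_nonneg measureReal_le_one))
  filter_upwards [htw.eventually_lt_const (u := 1 / 8) (by norm_num),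
    hR.eventually_gt_atTop 0, self_mem_nhdsWithin] with ε hsmall hRε hε
  have hxε := hx₀ ε hε
  have ht₁ : 1 ≤ t ε := le_add_of_nonneg_left (by positivity)
  rw [div_mul_eq_mul_div, mul_div_assoc, mul_div_cancel_right₀ _ hRε.ne'] at hsmall
  have hcrit : critValue w ε (x ε) + 1 ≤ t ε * bigA w ε :=
    calc critValue w ε (x ε) + 1 ≤ t ε * C₁ := by
          rw [ht, add_one_mul, div_mul_cancel₀ _ hC₁.ne']
          linarith
      _ ≤ t ε * bigA w ε := by gcongr; exact (hA ε hε).1.le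
  have hle := hw.le_log_typeI φ hε ht₁ hsmall.le hcrit
  have hbigA : t ε ^ 2 * bigA w ε ≤ t ε ^ 2 * C₂ := by gcongr; exact (hA ε hε).2.le
  rw [← div_eq_inv_mul, le_div_iff₀ (by positivity)]
  have hscale : (-(16 * C₂) * (t ε / R ε) ^ 2 - Real.log 4 * (R ε)⁻¹ ^ 2) * R ε ^ 2 =
      -16 * (t ε ^ 2 * C₂) - Real.log 4 := by
    field_simp
  linarith

/-- The critical values are `4 C₂ + 1 + 2 ε⁻⁴ energy` along a set of `ε` on which
`ε⁻⁴ energy = o(R)`, and `4 C₂ + 1` off that set. -/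
theorem exists_frequently_half_le_typeII (hφ : Orthonormal ℝ φ)
    (hR : Tendsto R (𝓝[>] 0) atTop)
    (hwR : Tendsto (fun ε => normWeight w ε 1 * R ε) (𝓝[>] 0) (𝓝 0))
    (hS : ¬ (fun ε => ε ^ 4 * R ε) =O[𝓝[>] 0] fun ε => energy φ w ε (S ε)) :
    ∃ x : ℝ → ℝ, (∀ ε > 0, 0 < typeI φ w ε (x ε) ∧ typeI φ w ε (x ε) < 1) ∧
      Tendsto (fun ε => (R ε ^ 2)⁻¹ * Real.log (typeI φ w ε (x ε))) (𝓝[>] 0) (𝓝 0) ∧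
      ∃ᶠ ε in 𝓝[>] 0, 1 / 2 ≤ typeII φ w ε (x ε) (S ε) := by
  obtain ⟨C₁, -, C₂, hC₂, hA⟩ := hw.A2
  set D : ℝ → ℝ := fun ε => energy φ w ε (S ε) / ε ^ 4
  have hD₀ (ε : ℝ) : 0 ≤ D ε := div_nonneg (energy_nonneg φ w ε _) (by positivity)
  obtain ⟨s, hs, hDs⟩ := exists_frequently_mem_indicator_isLittleO
    ((nhdsGT_le_nhdsNE 0).trans (nhdsNE_le_cofinite 0)) (mt (isBigO_pow_mul_of_isBigO_div 4) hS)
  set c : ℝ → ℝ := fun ε => 4 * C₂ + 1 + 2 * s.indicator D ε with hc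
  have hc₀ (ε : ℝ) : 0 < c ε := by
    have := Set.indicator_nonneg (s := s) (fun ε _ => hD₀ ε) ε
    positivity
  have hcR : c =o[𝓝[>] 0] R :=
    ((isLittleO_const_left.2 <| .inr <| tendsto_norm_atTop_atTop.comp hR).add
      (hDs.const_mul_left 2))
  choose! x hx using fun ε (hε : 0 < ε) => surjective_critValue hε (hw.bigA_pos hε) (c ε)
  refine ⟨x, fun ε hε => ⟨hw.typeI_pos φ hε _, hw.typeI_lt_one hφ hε ?_⟩,
    hw.tendsto_log_typeI φ hR hwR (fun ε hε => (hx ε hε).symm ▸ (hc₀ ε).le) (hcR.congr' ?_ .rfl),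
    ?_⟩
  · rw [hx ε hε]
    exact add_pos_of_nonneg_of_pos (tsum_nonneg (normWeight_nonneg w ε)) (hc₀ ε)
  · filter_upwards [self_mem_nhdsWithin] with ε hε using (hx ε hε).symm
  have hw₁ : ∀ᶠ ε in 𝓝[>] 0, normWeight w ε 1 < 1 / 4 := by
    filter_upwards [hwR.eventually_lt_const (u := 1 / 4) (by norm_num),
      hR.eventually_ge_atTop 1] with ε hsmall hRε
    exact (le_mul_of_one_le_right (normWeight_nonneg w ε 1) hRε).trans_lt hsmall
  refine (hs.and_eventually (hw₁.and self_mem_nhdsWithin)).mono fun ε ⟨hεs, hsmall, hε⟩ => ?_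
  have hle := hw.one_sub_typeII_le hφ hε zero_le_one (by linarith) (x ε) (S ε)
  rw [hx ε hε, hc] at hle
  simp only [Set.indicator_of_mem hεs] at hle
  have hexp : Real.exp (-1) ≤ 1 / 2 := by linarith [Real.exp_neg_one_lt_d9]
  have := hle.trans (Real.exp_le_exp.2 (show _ ≤ (-1 : ℝ) by linarith [(hA ε hε).2]))
  linarith

theorem ldConsistent_iff (hφ : Orthonormal ℝ φ) (hR : Tendsto R (𝓝[>] 0) atTop)
    (hwR : Tendsto (fun ε => normWeight w ε 1 * R ε) (𝓝[>] 0) (𝓝 0)) :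
    LDConsistent φ w R S ↔
      (fun ε => ε ^ 4 * R ε) =O[𝓝[>] 0] fun ε => energy φ w ε (S ε) := by
  refine ⟨fun hcons => ?_, fun hS x hα₀ hα =>
    hw.isBigO_log_typeII hφ hR hwR hS (fun ε hε => (hα₀ ε hε).2) hα⟩
  by_contra hS
  obtain ⟨x, hα₀, hα, hhalf⟩ := hw.exists_frequently_half_le_typeII hφ hR hwR hS
  obtain ⟨C, hC, hbound⟩ := (hcons x hα₀ hα).exists_pos
  obtain ⟨ε, hβ, hle, hRε⟩ := (hhalf.and_eventually (hbound.bound.and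
    (((tendsto_pow_atTop two_ne_zero).comp hR).eventually_gt_atTop (C * Real.log 2)))).exists
  have hlog := Real.log_le_log (by norm_num) hβ
  have hlog₀ : Real.log (typeII φ w ε (x ε) (S ε)) ≤ 0 :=
    Real.log_nonpos measureReal_nonneg measureReal_le_one
  rw [one_div, Real.log_inv] at hlog
  rw [Real.norm_of_nonneg (sq_nonneg _), Real.norm_eq_abs,
    abs_of_nonpos hlog₀] at hle
  exact (hRε.trans_le hle).not_ge (mul_le_mul_of_nonneg_left (neg_le.1 hlog) hC.le)

end Conditions

end ModerateDeviations

section WeightRates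

theorem bigA_mul_pow_four (w : ℝ → ℕ → ℝ) {ε : ℝ} (hε : 0 < ε) :
    bigA w ε * ε ^ 4 = ∑' j : ℕ+, (w ε j ^ 2) ^ 2 := by
  rw [bigA, mul_comm, mul_inv_cancel_left₀ (by positivity)]
  exact tsum_congr fun j => by ring

theorem kappaSq_nonneg (w : ℝ → ℕ → ℝ) (ε : ℝ) : 0 ≤ kappaSq w ε := sq_nonneg _

namespace Conditions

variable {w : ℝ → ℕ → ℝ} {ε : ℝ} (hw : Conditions w)

include hw

theorem sq_antitone (hε : 0 < ε) {i j : ℕ} (hi : 1 ≤ i) (hij : i ≤ j) :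
    w ε j ^ 2 ≤ w ε i ^ 2 :=
  hw.A1 ε hε hi (hi.trans hij) hij

theorem sq_first_pos (hε : 0 < ε) : 0 < w ε 1 ^ 2 :=
  (div_pos_iff_of_pos_right (by positivity)).1 (hw.normWeight_one_pos hε)

theorem rhoSq_pos (hε : 0 < ε) : 0 < rhoSq w ε := by
  have h := (hw.summable_normWeight hε).tsum_pos (normWeight_nonneg w ε) 1
    (hw.normWeight_one_pos hε)
  rw [tsum_normWeight] at h
  exact (div_pos_iff_of_pos_right (by positivity)).1 h

theorem tendsto_sum_Ico_sq (hε : 0 < ε) :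
    Tendsto (fun k => ∑ j ∈ Finset.Ico 1 k, w ε j ^ 2) atTop (𝓝 (rhoSq w ε)) := by
  have hsum : HasSum (fun n : ℕ => w ε (n + 1) ^ 2) (rhoSq w ε) := by
    rw [rhoSq, tsum_pnat_eq_tsum_succ (f := fun n : ℕ => w ε n ^ 2)]
    exact ((summable_pnat_iff_summable_succ (f := fun n : ℕ => w ε n ^ 2)).1
      (hw.summable ε hε)).hasSum
  refine (hsum.tendsto_sum_nat.comp (tendsto_sub_atTop_nat 1)).congr fun k => ?_
  simp [Finset.sum_Ico_eq_sum_range, add_comm]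

theorem bddAbove_sum_Ico_le (hε : 0 < ε) :
    BddAbove {k : ℕ | ∑ j ∈ Finset.Ico 1 k, w ε j ^ 2 ≤ rhoSq w ε / 2} := by
  obtain ⟨N, hN⟩ := eventually_atTop.1 ((hw.tendsto_sum_Ico_sq hε).eventually_const_lt
    (half_lt_self (hw.rhoSq_pos hε)))
  refine ⟨N, fun k hk => not_lt.1 fun hNk => ?_⟩
  exact (hN k hNk.le).not_ge hk

theorem one_le_kIdx (hε : 0 < ε) : 1 ≤ kIdx w ε := by
  refine le_csSup (hw.bddAbove_sum_Ico_le hε) ?_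
  rw [Set.mem_ofPred, Finset.Ico_self, Finset.sum_empty]
  exact (half_pos (hw.rhoSq_pos hε)).le

theorem rhoSq_le (hε : 0 < ε) : rhoSq w ε ≤ 2 * kIdx w ε * w ε 1 ^ 2 := by
  have hhalf : rhoSq w ε / 2 < ∑ j ∈ Finset.Ico 1 (kIdx w ε + 1), w ε j ^ 2 := by
    by_contra! h
    exact (Nat.lt_succ_self _).not_ge (le_csSup (hw.bddAbove_sum_Ico_le hε) h)
  have hsum := Finset.sum_le_card_nsmul (Finset.Ico 1 (kIdx w ε + 1)) (fun j => w ε j ^ 2) _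
    fun j hj => hw.sq_antitone hε le_rfl (Finset.mem_Ico.1 hj).1
  rw [Nat.card_Ico, nsmul_eq_mul, Nat.add_sub_cancel] at hsum
  linarith

theorem summable_sq_sq (hε : 0 < ε) : Summable fun j : ℕ+ => (w ε j ^ 2) ^ 2 :=
  (hw.summable_sq_mul_sq hε (hw.summable ε hε)).congr fun _ => (sq _).symm

theorem bigA_mul_le (hε : 0 < ε) : bigA w ε * ε ^ 4 ≤ 2 * (kIdx w ε * (w ε 1 ^ 2) ^ 2) :=
  calc bigA w ε * ε ^ 4 = ∑' j : ℕ+, (w ε j ^ 2) ^ 2 := bigA_mul_pow_four w hε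
    _ ≤ ∑' j : ℕ+, w ε 1 ^ 2 * w ε j ^ 2 := by
        refine (hw.summable_sq_sq hε).tsum_le_tsum (fun j => ?_) ((hw.summable ε hε).mul_left _)
        rw [sq (w ε j ^ 2)]
        exact mul_le_mul_of_nonneg_right (hw.sq_le_first hε j) (sq_nonneg _)
    _ = w ε 1 ^ 2 * rhoSq w ε := tsum_mul_left
    _ ≤ w ε 1 ^ 2 * (2 * kIdx w ε * w ε 1 ^ 2) := by gcongr; exact hw.rhoSq_le hε
    _ = 2 * (kIdx w ε * (w ε 1 ^ 2) ^ 2) := by ring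

theorem kIdx_mul_kappaSq_sq_le (hε : 0 < ε) :
    kIdx w ε * kappaSq w ε ^ 2 ≤ bigA w ε * ε ^ 4 := by
  let K : ℕ+ := ⟨kIdx w ε, hw.one_le_kIdx hε⟩
  have hsum := Finset.card_nsmul_le_sum (Finset.Icc 1 K) (fun j : ℕ+ => (w ε j ^ 2) ^ 2)
    (kappaSq w ε ^ 2) fun j hj => pow_le_pow_left₀ (sq_nonneg _)
      (hw.sq_antitone hε j.2 (Finset.mem_Icc.1 hj).2) 2
  rw [PNat.card_Icc, nsmul_eq_mul] at hsum
  rw [bigA_mul_pow_four w hε]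
  exact hsum.trans ((hw.summable_sq_sq hε).sum_le_tsum _ fun _ _ => by positivity)

theorem isTheta_bigA : bigA w =Θ[𝓝[>] 0] fun _ => (1 : ℝ) := by
  obtain ⟨C₁, hC₁, C₂, -, hA⟩ := hw.A2
  constructor
  · refine IsBigO.of_bound C₂ ?_
    filter_upwards [self_mem_nhdsWithin] with ε hε
    rw [norm_one, mul_one, Real.norm_of_nonneg (hw.bigA_pos hε).le]
    exact (hA ε hε).2.le
  · refine IsBigO.of_bound C₁⁻¹ ?_
    filter_upwards [self_mem_nhdsWithin] with ε hε
    rw [norm_one, Real.norm_of_nonneg (hw.bigA_pos hε).le, le_inv_mul_iff₀ hC₁, mul_one]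
    exact (hA ε hε).1.le

theorem isTheta_kIdx_mul_kappaSq_sq :
    (fun ε => kIdx w ε * kappaSq w ε ^ 2) =Θ[𝓝[>] 0] fun ε : ℝ => ε ^ 4 := by
  have hA : (fun ε => bigA w ε * ε ^ 4) =Θ[𝓝[>] 0] fun ε : ℝ => ε ^ 4 := by
    simpa only [one_mul] using
      hw.isTheta_bigA.mul (isTheta_refl (fun ε : ℝ => ε ^ 4) (𝓝[>] 0))
  refine ⟨(IsBigO.of_norm_eventuallyLE ?_).trans hA.1, hA.2.trans ?_⟩
  · filter_upwards [self_mem_nhdsWithin] with ε hε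
    rw [Real.norm_of_nonneg (by positivity)]
    exact hw.kIdx_mul_kappaSq_sq_le hε
  · refine (IsBigO.of_norm_eventuallyLE ?_).trans
      (((isBigO_refl _ _).mul (hw.A4_first.1.pow 2)).const_mul_left 2)
    filter_upwards [self_mem_nhdsWithin] with ε hε
    rw [Real.norm_of_nonneg (mul_nonneg (hw.bigA_pos hε).le (by positivity))]
    exact hw.bigA_mul_le hε

theorem isTheta_kappaSq {E : ℝ → ℝ}
    (hE : (fun ε => kIdx w ε * E ε ^ 2) =Θ[𝓝[>] 0] fun ε : ℝ => ε ^ 4) :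
    kappaSq w =Θ[𝓝[>] 0] E := by
  have hcancel (f : ℝ → ℝ) :
      (fun ε => (kIdx w ε : ℝ)⁻¹ * (kIdx w ε * f ε)) =ᶠ[𝓝[>] 0] f := by
    filter_upwards [self_mem_nhdsWithin] with ε hε
    exact inv_mul_cancel_left₀ (Nat.cast_ne_zero.2 (Nat.one_le_iff_ne_zero.1 (hw.one_le_kIdx hε))) _
  have hsq : (fun ε => kappaSq w ε ^ 2) =Θ[𝓝[>] 0] fun ε => E ε ^ 2 :=
    (hcancel _).symm.trans_isTheta <| IsTheta.trans_eventuallyEq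
      ((isTheta_refl (fun ε => (kIdx w ε : ℝ)⁻¹) _).mul
        (hw.isTheta_kIdx_mul_kappaSq_sq.trans hE.symm)) (hcancel _)
  exact ⟨hsq.1.of_pow two_ne_zero, hsq.2.of_pow two_ne_zero⟩

end Conditions

end WeightRates

section FourierSum

variable {ι E : Type*} [NormedAddCommGroup E] [InnerProductSpace ℝ E] {φ : ι → E}

/-- The partial sum over `F` of the Fourier series of `x` with respect to `φ`. When `φ` is
orthonormal this is the orthogonal projection of `x` onto the span of the `φ j`, `j ∈ F`. -/
def fourierSum (φ : ι → E) (F : Finset ι) (x : E) : E := ∑ j ∈ F, inner ℝ (φ j) x • φ j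

theorem inner_fourierSum_left (φ : ι → E) (F : Finset ι) (x y : E) :
    inner ℝ (fourierSum φ F x) y = ∑ j ∈ F, inner ℝ (φ j) x * inner ℝ (φ j) y := by
  simp only [fourierSum, sum_inner, real_inner_smul_left]

theorem inner_fourierSum_right (φ : ι → E) (F : Finset ι) (x y : E) :
    inner ℝ x (fourierSum φ F y) = inner ℝ (fourierSum φ F x) y := by
  rw [real_inner_comm, inner_fourierSum_left, inner_fourierSum_left]
  exact Finset.sum_congr rfl fun _ _ => mul_comm _ _

theorem norm_fourierSum_sq (hφ : Orthonormal ℝ φ) (F : Finset ι) (x : E) :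
    ‖fourierSum φ F x‖ ^ 2 = ∑ j ∈ F, inner ℝ (φ j) x ^ 2 := by
  rw [← real_inner_self_eq_norm_sq, inner_fourierSum_left]
  refine Finset.sum_congr rfl fun j hj => ?_
  rw [fourierSum, hφ.inner_right_sum _ hj, sq]

theorem norm_fourierSum_le (hφ : Orthonormal ℝ φ) (F : Finset ι) (x : E) :
    ‖fourierSum φ F x‖ ≤ ‖x‖ := by
  refine le_of_sq_le_sq ?_ (norm_nonneg x)
  simpa [norm_fourierSum_sq hφ] using hφ.sum_inner_products_le x (s := F)

theorem inner_fourierSum_sub_fourierSum (hφ : Orthonormal ℝ φ) (F : Finset ι) (x : E) :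
    inner ℝ (fourierSum φ F x) (x - fourierSum φ F x) = 0 := by
  rw [inner_sub_right, real_inner_self_eq_norm_sq, norm_fourierSum_sq hφ, inner_fourierSum_left,
    sub_eq_zero]
  exact Finset.sum_congr rfl fun _ _ => (sq _).symm

theorem norm_sq_eq_of_inner_sub_eq_zero {x y : E} (h : inner ℝ x (y - x) = 0) :
    ‖y‖ ^ 2 = ‖x‖ ^ 2 + ‖y - x‖ ^ 2 := by
  simpa [h] using norm_add_sq_real x (y - x)

theorem norm_sq_le_of_inner_sub_eq_zero (φ : ι → E) (F : Finset ι) {x y : E}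
    (h : inner ℝ x (y - x) = 0) :
    ‖x‖ ^ 2 ≤ ‖x‖ * ‖fourierSum φ F y‖ + ‖x - fourierSum φ F x‖ * ‖y‖ :=
  calc ‖x‖ ^ 2 = inner ℝ x y := by
        rw [inner_sub_right, sub_eq_zero] at h
        rw [h, real_inner_self_eq_norm_sq]
    _ = inner ℝ x (fourierSum φ F y) + inner ℝ (x - fourierSum φ F x) y := by
        rw [inner_fourierSum_right, ← inner_add_left, add_sub_cancel]
    _ ≤ _ := add_le_add (real_inner_le_norm _ _) (real_inner_le_norm _ _)

variable {θ : ι → ℝ} {x : E}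

theorem inner_eq_of_hasSum (hφ : Orthonormal ℝ φ) (hθ : HasSum (fun j => θ j • φ j) x) (i : ι) :
    inner ℝ (φ i) x = θ i := by
  have hinner : HasSum (fun j => inner ℝ (φ i) (θ j • φ j)) (inner ℝ (φ i) x) :=
    hθ.mapL (innerSL ℝ (φ i))
  refine hinner.unique ?_
  convert hasSum_single i fun j hj => ?_
  · rw [real_inner_smul_right, real_inner_self_eq_norm_sq, hφ.norm_eq_one, one_pow, mul_one]
  · rw [real_inner_smul_right, hφ.inner_eq_zero hj.symm, mul_zero]

theorem hasSum_sq_of_hasSum_smul (hφ : Orthonormal ℝ φ) (hθ : HasSum (fun j => θ j • φ j) x) :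
    HasSum (fun j => θ j ^ 2) (‖x‖ ^ 2) := by
  have hinner : HasSum (fun j => inner ℝ x (θ j • φ j)) (inner ℝ x x) := hθ.mapL (innerSL ℝ x)
  rw [real_inner_self_eq_norm_sq] at hinner
  refine hinner.congr_fun fun j => ?_
  rw [real_inner_smul_right, real_inner_comm, inner_eq_of_hasSum hφ hθ, sq]

theorem hasSum_fourierSum [DecidableEq ι] (φ : ι → E) (F : Finset ι) (x : E) :
    HasSum (fun j => (if j ∈ F then inner ℝ (φ j) x else 0) • φ j) (fourierSum φ F x) := by
  have hsum : fourierSum φ F x = ∑ j ∈ F, (if j ∈ F then inner ℝ (φ j) x else 0) • φ j :=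
    Finset.sum_congr rfl fun j hj => by rw [if_pos hj]
  rw [hsum]
  exact hasSum_sum_of_ne_finset_zero fun j hj => by rw [if_neg hj, zero_smul]

theorem hasSum_sub_fourierSum [DecidableEq ι] (hφ : Orthonormal ℝ φ)
    (hθ : HasSum (fun j => θ j • φ j) x) (F : Finset ι) :
    HasSum (fun j => (if j ∈ F then 0 else θ j) • φ j) (x - fourierSum φ F x) := by
  refine (hθ.sub (hasSum_fourierSum φ F x)).congr_fun fun j => ?_
  rw [inner_eq_of_hasSum hφ hθ, ← sub_smul]
  split_ifs <;> simp

end FourierSum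

section BesovBall

variable {φ : ℕ+ → L2Unit} {s P₀ : ℝ} {S : L2Unit}

theorem zero_mem_besovBall (φ : ℕ+ → L2Unit) (s : ℝ) (hP₀ : 0 ≤ P₀) : 0 ∈ besovBall φ s P₀ :=
  ⟨0, by simp [hasSum_zero], fun l _ => by simpa using hP₀⟩

theorem fourierSum_Iic_mem_besovBall (hφ : Orthonormal ℝ φ) (hs : 0 ≤ s) (S : L2Unit) (M : ℕ+)
    (h : (M : ℝ) ^ (2 * s) * ‖S‖ ^ 2 ≤ P₀) : fourierSum φ (Finset.Iic M) S ∈ besovBall φ s P₀ := by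
  refine ⟨_, hasSum_fourierSum φ (Finset.Iic M) S, fun l hl => ?_⟩
  let θ : ℕ+ → ℝ := fun j => if j ∈ Finset.Iic M then inner ℝ (φ j) S else 0
  have hθ : HasSum (fun j => θ j ^ 2) _ :=
    hasSum_sq_of_hasSum_smul hφ (hasSum_fourierSum φ (Finset.Iic M) S)
  change l ^ (2 * s) * ∑' j : ℕ+, (if l < (j : ℝ) then θ j ^ 2 else 0) ≤ P₀
  refine le_trans ?_ h
  rcases le_or_gt (M : ℝ) l with hM | hM
  · have hzero (j : ℕ+) : (if l < (j : ℝ) then θ j ^ 2 else 0) = 0 := by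
      refine ite_eq_right_iff.2 fun hj => ?_
      have hMj : M < j := by exact_mod_cast hM.trans_lt hj
      simp [θ, hMj]
    simp only [hzero, tsum_zero, mul_zero]
    positivity
  · have hnonneg (j : ℕ+) : 0 ≤ if l < (j : ℝ) then θ j ^ 2 else 0 := by
      split_ifs <;> positivity
    have hle (j : ℕ+) : (if l < (j : ℝ) then θ j ^ 2 else 0) ≤ θ j ^ 2 := by
      split_ifs
      exacts [le_rfl, sq_nonneg _]
    have htail : ∑' j : ℕ+, (if l < (j : ℝ) then θ j ^ 2 else 0) ≤ ‖S‖ ^ 2 :=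
      calc _ ≤ ∑' j, θ j ^ 2 :=
            (hθ.summable.of_nonneg_of_le hnonneg hle).tsum_le_tsum hle hθ.summable
        _ = ‖fourierSum φ (Finset.Iic M) S‖ ^ 2 := hθ.tsum_eq
        _ ≤ ‖S‖ ^ 2 := by gcongr; exact norm_fourierSum_le hφ _ S
    gcongr

theorem norm_sub_fourierSum_Iic_le (hφ : Orthonormal ℝ φ) (hS : S ∈ besovBall φ s P₀) (M : ℕ+) :
    ‖S - fourierSum φ (Finset.Iic M) S‖ ≤ √P₀ * (M : ℝ) ^ (-s) := by
  obtain ⟨θ, hθ, hP₀⟩ := hS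
  have hM : 0 < (M : ℝ) := by exact_mod_cast M.pos
  have htail : ∑' j : ℕ+, (if (M : ℝ) < (j : ℝ) then θ j ^ 2 else 0) =
      ‖S - fourierSum φ (Finset.Iic M) S‖ ^ 2 := by
    rw [← (hasSum_sq_of_hasSum_smul hφ (hasSum_sub_fourierSum hφ hθ (Finset.Iic M))).tsum_eq]
    refine tsum_congr fun j => ?_
    have hiff : (M : ℝ) < (j : ℝ) ↔ ¬ j ∈ Finset.Iic M := by
      rw [Finset.mem_Iic, not_le]
      norm_cast
    rw [if_congr hiff rfl rfl, ite_not, ite_pow, zero_pow two_ne_zero]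
  have hle := hP₀ M hM
  rw [htail, mul_comm 2 s, Real.rpow_mul hM.le, Real.rpow_two, ← mul_pow] at hle
  rw [Real.rpow_neg hM.le, ← div_eq_mul_inv, le_div_iff₀ (by positivity), mul_comm]
  exact Real.le_sqrt_of_sq_le hle

end BesovBall

section LowFrequencies

/-- The truncation index `[B k_ε]`, replaced by `1` where this integer part vanishes. -/
noncomputable def cutoff (w : ℝ → ℕ → ℝ) (B ε : ℝ) : ℕ+ := Nat.toPNat' ⌊B * (kIdx w ε : ℝ)⌋₊

variable {φ : ℕ+ → L2Unit} {w : ℝ → ℕ → ℝ} {X : ℝ → ℝ} {S : ℝ → L2Unit} {s B ε : ℝ}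

theorem sq_mul_norm_fourierSum_Iic_sq_le_energy (hw : Conditions w) (hφ : Orthonormal ℝ φ)
    (hε : 0 < ε) (M : ℕ+) (S : L2Unit) :
    w ε M ^ 2 * ‖fourierSum φ (Finset.Iic M) S‖ ^ 2 ≤ energy φ w ε S :=
  calc w ε M ^ 2 * ‖fourierSum φ (Finset.Iic M) S‖ ^ 2
      = ∑ j ∈ Finset.Iic M, w ε M ^ 2 * coeff φ S j ^ 2 := by
        rw [norm_fourierSum_sq hφ, Finset.mul_sum]
        rfl
    _ ≤ ∑ j ∈ Finset.Iic M, w ε j ^ 2 * coeff φ S j ^ 2 := by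
        refine Finset.sum_le_sum fun j hj => mul_le_mul_of_nonneg_right ?_ (sq_nonneg _)
        exact hw.sq_antitone hε j.2 (PNat.coe_le_coe _ _ |>.2 (Finset.mem_Iic.1 hj))
    _ ≤ energy φ w ε S :=
        (hw.summable_sq_mul_sq hε (summable_coeff_sq hφ S)).sum_le_tsum _ fun _ _ => by positivity

theorem energy_le_sq_mul_norm_fourierSum_Iic_sq_add (hw : Conditions w) (hφ : Orthonormal ℝ φ)
    (hε : 0 < ε) (M : ℕ+) (S : L2Unit) :
    energy φ w ε S ≤
      w ε 1 ^ 2 * ‖fourierSum φ (Finset.Iic M) S‖ ^ 2 + w ε M ^ 2 * ‖S‖ ^ 2 := by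
  have hcoeff := summable_coeff_sq hφ S
  have henergy := hw.summable_sq_mul_sq hε hcoeff
  rw [energy, ← henergy.sum_add_tsum_compl (s := Finset.Iic M), norm_fourierSum_sq hφ,
    Finset.mul_sum]
  refine add_le_add (Finset.sum_le_sum fun j _ =>
    mul_le_mul_of_nonneg_right (hw.sq_le_first hε j) (sq_nonneg _)) ?_
  calc ∑' j : ↑((Finset.Iic M : Set ℕ+)ᶜ), w ε j ^ 2 * coeff φ S j ^ 2
      ≤ ∑' j : ↑((Finset.Iic M : Set ℕ+)ᶜ), w ε M ^ 2 * coeff φ S j ^ 2 := by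
        refine (henergy.subtype _).tsum_le_tsum (fun j => ?_) ((hcoeff.subtype _).mul_left _)
        have hj : M < j := by simpa using j.2
        exact mul_le_mul_of_nonneg_right (hw.sq_antitone hε M.2 hj.le) (sq_nonneg _)
    _ = w ε M ^ 2 * ∑' j : ↑((Finset.Iic M : Set ℕ+)ᶜ), coeff φ S j ^ 2 := tsum_mul_left
    _ ≤ w ε M ^ 2 * ‖S‖ ^ 2 := by
        gcongr
        refine (hcoeff.tsum_subtype_le _ _ fun _ => sq_nonneg _).trans ?_
        simpa [coeff] using hφ.tsum_inner_products_le S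

namespace Conditions

variable (hw : Conditions w)

include hw

theorem coe_cutoff (hB : 1 < B) (hε : 0 < ε) :
    (cutoff w B ε : ℕ) = ⌊B * (kIdx w ε : ℝ)⌋₊ := by
  have hk : (1 : ℝ) ≤ kIdx w ε := by exact_mod_cast hw.one_le_kIdx hε
  rw [cutoff, Nat.toPNat'_coe, if_pos (Nat.floor_pos.2 (one_le_mul_of_one_le_of_one_le hB.le hk))]

theorem cutoff_le (hB : 1 < B) (hε : 0 < ε) : (cutoff w B ε : ℝ) ≤ B * kIdx w ε := by
  rw [hw.coe_cutoff hB hε]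
  exact Nat.floor_le (by positivity)

theorem le_cutoff (hB : 1 < B) (hε : 0 < ε) : B / 2 * kIdx w ε ≤ cutoff w B ε := by
  have hone : (1 : ℝ) ≤ (cutoff w B ε : ℕ) := by exact_mod_cast (cutoff w B ε).2
  have hfloor := (Nat.lt_floor_add_one (B * (kIdx w ε : ℝ))).le
  rw [← hw.coe_cutoff hB hε] at hfloor
  linarith

theorem exists_sq_cutoff_lt :
    ∃ C > 0, ∃ lam > 1, ∀ B > 1, ∀ ε > 0,
      w ε (cutoff w B ε) ^ 2 < C * B ^ (-lam : ℝ) * kappaSq w ε := by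
  obtain ⟨C, hC, lam, hlam, hA3⟩ := hw.A3
  refine ⟨C, hC, lam, hlam, fun B hB ε hε => ?_⟩
  simpa only [hw.coe_cutoff hB hε, add_sub_cancel] using hA3 (B - 1) (sub_pos.2 hB) ε hε

theorem exists_mul_kappaSq_le_sq_cutoff (hB : 1 < B) :
    ∃ C > 0, ∀ ε > 0, C * kappaSq w ε ≤ w ε (cutoff w B ε) ^ 2 := by
  obtain ⟨C, hC, hA4⟩ := hw.A4_tail B hB
  exact ⟨C, hC, fun ε hε => by simpa only [hw.coe_cutoff hB hε] using hA4 ε hε⟩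

theorem isBigO_energy (hφ : Orthonormal ℝ φ) (hB : 1 < B)
    (hX : X =O[𝓝[>] 0] fun ε => ‖fourierSum φ (Finset.Iic (cutoff w B ε)) (S ε)‖) :
    (fun ε => kappaSq w ε * X ε ^ 2) =O[𝓝[>] 0] fun ε => energy φ w ε (S ε) := by
  obtain ⟨C, hC, hle⟩ := hw.exists_mul_kappaSq_le_sq_cutoff hB
  refine ((isBigO_refl (kappaSq w) _).mul (hX.pow 2)).trans (IsBigO.of_bound C⁻¹ ?_)
  filter_upwards [self_mem_nhdsWithin] with ε hε
  rw [Real.norm_of_nonneg (mul_nonneg (kappaSq_nonneg w ε) (sq_nonneg _)),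
    Real.norm_of_nonneg (energy_nonneg φ w ε (S ε)), le_inv_mul_iff₀ hC, ← mul_assoc]
  exact (mul_le_mul_of_nonneg_right (hle ε hε) (sq_nonneg _)).trans
    (sq_mul_norm_fourierSum_Iic_sq_le_energy hw hφ hε _ _)

theorem exists_isBigO_norm_fourierSum (hφ : Orthonormal ℝ φ)
    (hS : (fun ε => ‖S ε‖) =O[𝓝[>] 0] X)
    (hX : (fun ε => kappaSq w ε * X ε ^ 2) =O[𝓝[>] 0] fun ε => energy φ w ε (S ε)) :
    ∃ B > 1, X =O[𝓝[>] 0] fun ε => ‖fourierSum φ (Finset.Iic (cutoff w B ε)) (S ε)‖ := by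
  obtain ⟨b, hb, hfirst⟩ := hw.A4_first.1.exists_pos
  obtain ⟨m, hm, hSm⟩ := hS.exists_pos
  obtain ⟨c, hc, hXc⟩ := hX.exists_pos
  obtain ⟨C, hC, lam, hlam, hcut⟩ := hw.exists_sq_cutoff_lt
  obtain ⟨B, hB_small, hB⟩ : ∃ B : ℝ, c * (C * B ^ (-lam)) * m ^ 2 ≤ 1 / 2 ∧ 1 < B := by
    have hlim := (((tendsto_rpow_neg_atTop (zero_lt_one.trans hlam)).const_mul C).const_mul
      c).mul_const (m ^ 2)
    simp only [mul_zero, zero_mul] at hlim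
    exact ((hlim.eventually_le_const one_half_pos).and (eventually_gt_atTop 1)).exists
  refine ⟨B, hB, IsBigO.of_pow two_ne_zero (IsBigO.of_bound (2 * (c * b)) ?_)⟩
  filter_upwards [hfirst.bound, hSm.bound, hXc.bound, self_mem_nhdsWithin] with ε hfirst hS hX hε
  have hκ := kappaSq_nonneg w ε
  rw [Real.norm_of_nonneg (sq_nonneg _), Real.norm_of_nonneg hκ] at hfirst
  rw [norm_norm, Real.norm_eq_abs] at hS
  rw [Real.norm_of_nonneg (mul_nonneg hκ (sq_nonneg _)),
    Real.norm_of_nonneg (energy_nonneg φ w ε (S ε))] at hX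
  simp only [Pi.pow_apply, norm_pow, Real.norm_eq_abs, sq_abs]
  have hκ_pos : 0 < kappaSq w ε :=
    pos_of_mul_pos_right ((hw.sq_first_pos hε).trans_le hfirst) hb.le
  set P := ‖fourierSum φ (Finset.Iic (cutoff w B ε)) (S ε)‖
  have hmain : kappaSq w ε * X ε ^ 2 ≤
      kappaSq w ε * (c * b * P ^ 2 + 1 / 2 * X ε ^ 2) :=
    calc kappaSq w ε * X ε ^ 2 ≤ c * energy φ w ε (S ε) := hX
      _ ≤ c * (w ε 1 ^ 2 * P ^ 2 + w ε (cutoff w B ε) ^ 2 * ‖S ε‖ ^ 2) := by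
          gcongr
          exact energy_le_sq_mul_norm_fourierSum_Iic_sq_add hw hφ hε _ _
      _ ≤ c * (b * kappaSq w ε * P ^ 2 + C * B ^ (-lam) * kappaSq w ε * (m * |X ε|) ^ 2) := by
          gcongr
          exact (hcut B hB ε hε).le
      _ = kappaSq w ε * (c * b * P ^ 2 + c * (C * B ^ (-lam)) * m ^ 2 * X ε ^ 2) := by
          rw [mul_pow, sq_abs]
          ring
      _ ≤ kappaSq w ε * (c * b * P ^ 2 + 1 / 2 * X ε ^ 2) := by gcongr
  linarith [le_of_mul_le_mul_left hmain hκ_pos]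

theorem isBigO_energy_iff (hφ : Orthonormal ℝ φ) (hS : (fun ε => ‖S ε‖) =O[𝓝[>] 0] X) :
    (fun ε => kappaSq w ε * X ε ^ 2) =O[𝓝[>] 0] (fun ε => energy φ w ε (S ε)) ↔
      ∃ B > 1, X =O[𝓝[>] 0] fun ε => ‖fourierSum φ (Finset.Iic (cutoff w B ε)) (S ε)‖ :=
  ⟨hw.exists_isBigO_norm_fourierSum hφ hS, fun ⟨_, hB, h⟩ => hw.isBigO_energy hφ hB h⟩

theorem cutoff_rpow_mul_norm_sq_le (hs : 0 ≤ s) (hB : 1 < B) (hε : 0 < ε) {m : ℝ} {S : L2Unit}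
    (hS : ‖S‖ ≤ m * (kIdx w ε : ℝ) ^ (-s)) :
    (cutoff w B ε : ℝ) ^ (2 * s) * ‖S‖ ^ 2 ≤ (B ^ s * m) ^ 2 := by
  have hk : 0 < (kIdx w ε : ℝ) := by exact_mod_cast hw.one_le_kIdx hε
  have hB₀ : 0 ≤ B := zero_le_one.trans hB.le
  rw [mul_comm 2 s, Real.rpow_mul (by positivity), Real.rpow_two, ← mul_pow]
  refine pow_le_pow_left₀ (by positivity) ?_ 2
  calc (cutoff w B ε : ℝ) ^ s * ‖S‖
      ≤ (B * kIdx w ε) ^ s * (m * (kIdx w ε : ℝ) ^ (-s)) := by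
        gcongr
        exact hw.cutoff_le hB hε
    _ = B ^ s * m := by
        rw [Real.mul_rpow hB₀ hk.le, Real.rpow_neg hk.le]
        field_simp

theorem exists_besovBall_of_isBigO (hφ : Orthonormal ℝ φ) (hs : 0 ≤ s)
    (hX : X =Θ[𝓝[>] 0] fun ε => (kIdx w ε : ℝ) ^ (-s)) (hS : (fun ε => ‖S ε‖) =O[𝓝[>] 0] X)
    (hB : 1 < B) (h : X =O[𝓝[>] 0] fun ε => ‖fourierSum φ (Finset.Iic (cutoff w B ε)) (S ε)‖) :
    ∃ P₀ > 0, ∃ S₁ : ℝ → L2Unit, (∀ ε > 0, S₁ ε ∈ besovBall φ s P₀) ∧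
      (fun ε => ‖S₁ ε‖) =Θ[𝓝[>] 0] X ∧ ∀ ε > 0, inner ℝ (S₁ ε) (S ε - S₁ ε) = 0 := by
  obtain ⟨m, hm, hSm⟩ := (hS.trans hX.1).exists_pos
  classical
  let S₁ (ε : ℝ) : L2Unit := if ‖S ε‖ ≤ m * (kIdx w ε : ℝ) ^ (-s) then
    fourierSum φ (Finset.Iic (cutoff w B ε)) (S ε) else 0
  have hS₁ : (fun ε => ‖S₁ ε‖) =ᶠ[𝓝[>] 0]
      fun ε => ‖fourierSum φ (Finset.Iic (cutoff w B ε)) (S ε)‖ := by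
    filter_upwards [hSm.bound] with ε hε
    rw [norm_norm, Real.norm_of_nonneg (by positivity)] at hε
    simp only [S₁, if_pos hε]
  refine ⟨(B ^ s * m) ^ 2, by positivity, S₁, fun ε hε => ?_,
    hS₁.trans_isTheta ⟨(IsBigO.of_norm_le fun ε => ?_).trans hS, h⟩, fun ε _ => ?_⟩
  · by_cases hε' : ‖S ε‖ ≤ m * (kIdx w ε : ℝ) ^ (-s)
    · simpa only [S₁, if_pos hε'] using fourierSum_Iic_mem_besovBall hφ hs (S ε) _
        (hw.cutoff_rpow_mul_norm_sq_le hs hB hε hε')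
    · simpa only [S₁, if_neg hε'] using zero_mem_besovBall φ s (sq_nonneg _)
  · rw [norm_norm]
    exact norm_fourierSum_le hφ _ _
  · simp only [S₁]
    split_ifs
    exacts [inner_fourierSum_sub_fourierSum hφ _ _, inner_zero_left _]

theorem norm_sub_fourierSum_cutoff_le (hφ : Orthonormal ℝ φ) (hs : 0 ≤ s) (hB : 1 < B)
    (hε : 0 < ε) {P₀ : ℝ} {S : L2Unit} (hS : S ∈ besovBall φ s P₀) :
    ‖S - fourierSum φ (Finset.Iic (cutoff w B ε)) S‖ ≤
      √P₀ * (B / 2) ^ (-s) * (kIdx w ε : ℝ) ^ (-s) := by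
  have hk : 0 < (kIdx w ε : ℝ) := by exact_mod_cast hw.one_le_kIdx hε
  have hB₀ : 0 < B / 2 := half_pos (zero_lt_one.trans hB)
  refine (norm_sub_fourierSum_Iic_le hφ hS _).trans ?_
  rw [mul_assoc, ← Real.mul_rpow hB₀.le hk.le]
  gcongr ?_ * ?_
  exact Real.rpow_le_rpow_of_nonpos (by positivity) (hw.le_cutoff hB hε) (neg_nonpos.2 hs)

theorem exists_isBigO_of_besovBall (hφ : Orthonormal ℝ φ) (hs : 0 < s)
    (hX : X =Θ[𝓝[>] 0] fun ε => (kIdx w ε : ℝ) ^ (-s)) (hS : (fun ε => ‖S ε‖) =O[𝓝[>] 0] X)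
    {P₀ : ℝ} {S₁ : ℝ → L2Unit} (hball : ∀ ε > 0, S₁ ε ∈ besovBall φ s P₀)
    (hS₁ : X =O[𝓝[>] 0] fun ε => ‖S₁ ε‖)
    (horth : ∀ ε > 0, inner ℝ (S₁ ε) (S ε - S₁ ε) = 0) :
    ∃ B > 1, X =O[𝓝[>] 0] fun ε => ‖fourierSum φ (Finset.Iic (cutoff w B ε)) (S ε)‖ := by
  obtain ⟨m, hm, hSm⟩ := (hS.trans hX.1).exists_pos
  obtain ⟨n, hn, hSn⟩ := (hX.2.trans hS₁).exists_pos
  obtain ⟨B, hB_small, hB⟩ : ∃ B : ℝ, √P₀ * (B / 2) ^ (-s) * m * n ^ 2 ≤ 1 / 2 ∧ 1 < B := by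
    have hlim := ((((tendsto_rpow_neg_atTop hs).comp
      (tendsto_id.atTop_div_const two_pos)).const_mul √P₀).mul_const m).mul_const (n ^ 2)
    simp only [mul_zero, zero_mul] at hlim
    exact ((hlim.eventually_le_const one_half_pos).and (eventually_gt_atTop 1)).exists
  refine ⟨B, hB, hS₁.trans (IsBigO.of_bound 2 ?_)⟩
  filter_upwards [hSm.bound, hSn.bound, self_mem_nhdsWithin] with ε hSm hSn hε
  have hB₀ : 0 < B / 2 := half_pos (zero_lt_one.trans hB)
  rw [norm_norm, Real.norm_of_nonneg (by positivity)] at hSm hSn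
  rw [norm_norm, norm_norm]
  set P := ‖fourierSum φ (Finset.Iic (cutoff w B ε)) (S ε)‖
  have htail : ‖S₁ ε - fourierSum φ (Finset.Iic (cutoff w B ε)) (S₁ ε)‖ * ‖S ε‖ ≤
      1 / 2 * ‖S₁ ε‖ ^ 2 :=
    calc _ ≤ √P₀ * (B / 2) ^ (-s) * (kIdx w ε : ℝ) ^ (-s) * (m * (kIdx w ε : ℝ) ^ (-s)) := by
          gcongr
          exact hw.norm_sub_fourierSum_cutoff_le hφ hs.le hB hε (hball ε hε)
      _ = √P₀ * (B / 2) ^ (-s) * m * ((kIdx w ε : ℝ) ^ (-s)) ^ 2 := by ring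
      _ ≤ √P₀ * (B / 2) ^ (-s) * m * (n * ‖S₁ ε‖) ^ 2 := by gcongr
      _ = √P₀ * (B / 2) ^ (-s) * m * n ^ 2 * ‖S₁ ε‖ ^ 2 := by ring
      _ ≤ 1 / 2 * ‖S₁ ε‖ ^ 2 := by gcongr
  have hsq : ‖S₁ ε‖ * ‖S₁ ε‖ ≤ ‖S₁ ε‖ * (2 * P) := by
    linarith [norm_sq_le_of_inner_sub_eq_zero φ (Finset.Iic (cutoff w B ε)) (horth ε hε)]
  rcases (norm_nonneg (S₁ ε)).eq_or_lt with hzero | hpos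
  · rw [← hzero]
    positivity
  · exact le_of_mul_le_mul_left hsq hpos

theorem exists_besovBall_iff (hφ : Orthonormal ℝ φ) (hs : 0 < s)
    (hX : X =Θ[𝓝[>] 0] fun ε => (kIdx w ε : ℝ) ^ (-s)) (hS : (fun ε => ‖S ε‖) =O[𝓝[>] 0] X) :
    (∃ B > 1, X =O[𝓝[>] 0] fun ε => ‖fourierSum φ (Finset.Iic (cutoff w B ε)) (S ε)‖) ↔
      ∃ P₀ > 0, ∃ S₁ : ℝ → L2Unit, (∀ ε > 0, S₁ ε ∈ besovBall φ s P₀) ∧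
        (fun ε => ‖S₁ ε‖) =Θ[𝓝[>] 0] X ∧ ∀ ε > 0, inner ℝ (S₁ ε) (S ε - S₁ ε) = 0 :=
  ⟨fun ⟨_, hB, h⟩ => hw.exists_besovBall_of_isBigO hφ hs.le hX hS hB h,
    fun ⟨_, _, _, hball, hS₁, horth⟩ =>
      hw.exists_isBigO_of_besovBall hφ hs hX hS hball hS₁.2 horth⟩

end Conditions

end LowFrequencies

section Rates

variable {w : ℝ → ℕ → ℝ} {r ω : ℝ}

theorem isTheta_rpow_mul {f : ℝ → ℝ} (hf : 0 ≤ f) {p q : ℝ}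
    (hfp : f =Θ[𝓝[>] 0] fun ε => ε ^ p) :
    (fun ε : ℝ => ε ^ (p * q)) =Θ[𝓝[>] 0] fun ε => f ε ^ q := by
  refine EventuallyEq.trans_isTheta (f₂ := fun ε : ℝ => (ε ^ p) ^ q) ?_
    (IsTheta.rpow ?_ (.of_forall hf) hfp.symm)
  · filter_upwards [self_mem_nhdsWithin] with ε hε
    exact Real.rpow_mul (le_of_lt hε) p q
  · filter_upwards [self_mem_nhdsWithin] with ε hε
    exact Real.rpow_nonneg (le_of_lt hε) p

namespace Conditions

variable (hw : Conditions w)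

include hw

theorem isTheta_kappaSq_rpow
    (hk : (fun ε : ℝ => (kIdx w ε : ℝ)) =Θ[𝓝[>] 0] fun ε => ε ^ (-4 + 8 * r + 4 * ω)) :
    kappaSq w =Θ[𝓝[>] 0] fun ε => ε ^ (4 - 4 * r - 2 * ω) := by
  refine hw.isTheta_kappaSq ((hk.mul (isTheta_refl _ _)).trans_eventuallyEq ?_)
  filter_upwards [self_mem_nhdsWithin] with ε hε
  rw [← Real.rpow_mul_natCast hε.le, ← Real.rpow_add hε, ← Real.rpow_natCast ε 4]
  congr 1
  push_cast
  ring

theorem isTheta_pow_four_mul_rpow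
    (hk : (fun ε : ℝ => (kIdx w ε : ℝ)) =Θ[𝓝[>] 0] fun ε => ε ^ (-4 + 8 * r + 4 * ω)) :
    (fun ε : ℝ => ε ^ 4 * ε ^ (-2 * ω)) =Θ[𝓝[>] 0]
      fun ε => kappaSq w ε * (ε ^ (2 * r)) ^ 2 := by
  refine EventuallyEq.trans_isTheta ?_
    ((hw.isTheta_kappaSq_rpow hk).symm.mul (isTheta_refl (fun ε : ℝ => (ε ^ (2 * r)) ^ 2) _))
  filter_upwards [self_mem_nhdsWithin] with ε hε
  rw [← Real.rpow_mul_natCast hε.le, ← Real.rpow_add hε, ← Real.rpow_natCast ε 4,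
    ← Real.rpow_add hε]
  congr 1
  push_cast
  ring

theorem tendsto_normWeight_one_mul_rpow (hω : 2 * ω < 1 - 2 * r)
    (hk : (fun ε : ℝ => (kIdx w ε : ℝ)) =Θ[𝓝[>] 0] fun ε => ε ^ (-4 + 8 * r + 4 * ω)) :
    Tendsto (fun ε => normWeight w ε 1 * ε ^ (-2 * ω)) (𝓝[>] 0) (𝓝 0) := by
  have hlim : Tendsto (fun ε : ℝ => ε ^ (2 - 4 * r - 4 * ω)) (𝓝[>] 0) (𝓝 0) := by
    have hpos : 0 < 2 - 4 * r - 4 * ω := by linarith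
    simpa [Real.zero_rpow hpos.ne'] using
      (Real.continuousAt_rpow_const 0 _ (Or.inr hpos.le)).tendsto.mono_left nhdsWithin_le_nhds
  refine IsBigO.trans_tendsto ?_ hlim
  have hfirst : (fun ε => w ε 1 ^ 2) =O[𝓝[>] 0] fun ε => ε ^ (4 - 4 * r - 2 * ω) :=
    hw.A4_first.1.trans (hw.isTheta_kappaSq_rpow hk).1
  refine ((hfirst.mul (isBigO_refl (fun ε : ℝ => (ε ^ 2)⁻¹) _)).mul
    (isBigO_refl (fun ε : ℝ => ε ^ (-2 * ω)) _)).congr' (.of_forall fun ε => ?_) ?_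
  · simp only [normWeight, PNat.one_coe, div_eq_mul_inv]
  · filter_upwards [self_mem_nhdsWithin] with ε hε
    rw [← Real.rpow_natCast ε 2, ← Real.rpow_neg hε.le, ← Real.rpow_add hε, ← Real.rpow_add hε]
    congr 1
    push_cast
    ring

end Conditions

end Rates

end WhiteNoise

theorem mainTheorem3_general
    (φ : ℕ+ → L2Unit) (hφ : Orthonormal ℝ φ)
    (w : ℝ → ℕ → ℝ) (hw : WhiteNoise.Conditions w)
    (r ω : ℝ) (hr₀ : 0 < r) (hω₀ : 0 < 2 * ω) (hω₁ : 2 * ω < 1 - 2 * r)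
    (hk : (fun ε : ℝ => (WhiteNoise.kIdx w ε : ℝ)) =Θ[𝓝[>] 0]
      fun ε : ℝ => ε ^ (-4 + 8 * r + 4 * ω))
    (S : ℝ → L2Unit) (hS : (fun ε : ℝ => ‖S ε‖) =O[𝓝[>] 0] fun ε : ℝ => ε ^ (2 * r)) :
    WhiteNoise.LDConsistent φ w (fun ε : ℝ => ε ^ (-2 * ω)) S ↔
      ∃ P₀ : ℝ, 0 < P₀ ∧ ∃ S₁ : ℝ → L2Unit,
        (∀ ε > 0, S₁ ε ∈ WhiteNoise.besovBall φ (r / (2 - 4 * r - 2 * ω)) P₀) ∧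
        ((fun ε : ℝ => ‖S₁ ε‖) =Θ[𝓝[>] 0] fun ε : ℝ => ε ^ (2 * r)) ∧
        ∀ ε > 0, inner ℝ (S₁ ε) (S ε - S₁ ε) = 0 ∧
          ‖S ε‖ ^ 2 = ‖S₁ ε‖ ^ 2 + ‖S ε - S₁ ε‖ ^ 2 := by
  have hden : 0 < 2 - 4 * r - 2 * ω := by linarith
  have hR : Tendsto (fun ε : ℝ => ε ^ (-2 * ω)) (𝓝[>] 0) atTop :=
    tendsto_rpow_neg_nhdsGT_zero (by linarith)
  have hX : (fun ε : ℝ => ε ^ (2 * r)) =Θ[𝓝[>] 0]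
      fun ε => (WhiteNoise.kIdx w ε : ℝ) ^ (-(r / (2 - 4 * r - 2 * ω))) := by
    convert WhiteNoise.isTheta_rpow_mul (fun ε => (WhiteNoise.kIdx w ε).cast_nonneg) hk using 3
    linear_combination -2 * div_mul_cancel₀ r hden.ne'
  rw [hw.ldConsistent_iff hφ hR (hw.tendsto_normWeight_one_mul_rpow hω₁ hk),
    (hw.isTheta_pow_four_mul_rpow hk).isBigO_congr_left, hw.isBigO_energy_iff hφ hS,
    hw.exists_besovBall_iff hφ (div_pos hr₀ hden) hX hS]
  simp only [gt_iff_lt, and_iff_left_of_imp WhiteNoise.norm_sq_eq_of_inner_sub_eq_zero]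

theorem mainTheorem3
    (φ : ℕ+ → L2Unit) (hφ : Orthonormal ℝ φ)
    (w : ℝ → ℕ → ℝ) (hw : WhiteNoise.Conditions w)
    (r ω : ℝ) (hr₀ : 0 < r) (hr₁ : r < 1 / 2) (hω₀ : 0 < 2 * ω) (hω₁ : 2 * ω < 1 - 2 * r)
    (hk : (fun ε : ℝ => (WhiteNoise.kIdx w ε : ℝ)) =Θ[𝓝[>] 0]
      fun ε : ℝ => ε ^ (-4 + 8 * r + 4 * ω))
    (S : ℝ → L2Unit) (hS : (fun ε : ℝ => ‖S ε‖) =Θ[𝓝[>] 0] fun ε : ℝ => ε ^ (2 * r)) :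
    WhiteNoise.LDConsistent φ w (fun ε : ℝ => ε ^ (-2 * ω)) S ↔
      ∃ P₀ : ℝ, 0 < P₀ ∧ ∃ S₁ : ℝ → L2Unit,
        (∀ ε > 0, S₁ ε ∈ WhiteNoise.besovBall φ (r / (2 - 4 * r - 2 * ω)) P₀) ∧
        ((fun ε : ℝ => ‖S₁ ε‖) =Θ[𝓝[>] 0] fun ε : ℝ => ε ^ (2 * r)) ∧
        ∀ ε > 0, inner ℝ (S₁ ε) (S ε - S₁ ε) = 0 ∧
          ‖S ε‖ ^ 2 = ‖S₁ ε‖ ^ 2 + ‖S ε - S₁ ε‖ ^ 2 :=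
  mainTheorem3_general φ hφ w hw r ω hr₀ hω₀ hω₁ hk S hS.isBigO
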